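/- **Theorem (quantum ergodicity at logarithmic scales in phase space).** *Quantum cat maps.* Let $M=\begin{pmatrix}A&B\\ C&D_0\end{pmatrix}\in\mathrm{SL}(2,\mathbb Z)$ with $|\mathrm{Tr}\,M|>2$, and $h=1/N$, $N\in\mathbb N$, $N\ge1$. Let $\hat M$ be its quantization on tempered distributions on $\mathbb R$, i.e. the operator with kernel $(ihB)^{-1/2}\exp\!\big(\tfrac{\pi i}{hB}(D_0q^2-2qq'+Aq'^2)\big)$; if $\mathrm{Tr}\,M>2$ this is the propagator $e^{-2\pi i\hat H/h}$ of the quadratic Hamiltonian whose classical flow at time $1$ is $M$. Let $\hat T_v f(q)=e^{\frac{2\pi i}{h}v_2(q-v_1/2)}f(q-v_1)$ and $\hat T_N(n)=\hat T_{n/N}$ for $n\in\mathbb Z^2$. For $\kappa\in\mathbb R^2$ let $\mathcal H_{N,\kappa}$ be the $N$-dimensional space of distributions $\psi=\sum_{k\in\mathbb Z}\Psi(k)\,\delta(q-(k+\kappa_1)/N)$ with $\Psi(k+N)=e^{-2\pi i\kappa_2}\Psi(k)$ and $\langle\psi,\phi\rangle=\frac1N\sum_{k=1}^N\Psi(k)\overline{\Phi(k)}$.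 For each $N$ fix any $\kappa=\kappa(N)$ such that $\hat M\mathcal H_{N,\kappa}\subseteq\mathcal H_{N,\kappa}$ and write $\mathcal H_N=\mathcal H_{N,\kappa(N)}$. An eigenbasis is an orthonormal basis $\{\phi_j\}_{j=1}^N$ of $\mathcal H_N$ with $\hat M\phi_j=e^{i\theta_j}\phi_j$, $\theta_j\in\mathbb R$. For a trigonometric polynomial $a(x)=\sum_{n}\tilde a(n)e^{2\pi i(n_2x_1-n_1x_2)}$ on $\mathbb T^2=\mathbb R^2/\mathbb Z^2$ put $\mathrm{Op}_N(a)=\sum_n\tilde a(n)\hat T_N(n)$. *Majorants and minorants.* Let $0\le\alpha<1/4$, $r=r(N)=(\log N)^{-\alpha}$, and let $D=D(N)$ satisfy $1/D=o(r)$, $D>0$ for large $N$, and $D^4=o(\log N)$ as $N\to\infty$ (for instance $D=(\log N)^\beta$ with $\alpha<\beta<1/4$). Let $B_2(x,r)\subset\mathbb T^2$ be the open geodesic ball. Call real-valued trigonometric polynomials $a_N^\pm$ on $\mathbb T^2$ *admissible* if for some constant $c$ and all large $N$: $a_N^-\le\chi_{B_2(0,r)}\le a_N^+$; $\widetilde{a_N^\pm}(n)=0$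 for $|n|\ge D$; $|\widetilde{a_N^\pm}(n)|\le cr^2$ for all $n$; and if $\widetilde{a_N^\pm}(0)=\mathrm{Vol}(B_2(0,r))+o(r^2)$ as $N\to\infty$. Put $b^\pm_{x,r}=a_N^\pm(\cdot-x)$. *Conclusion.* Admissible $a_N^\pm$ exist. For every choice of admissible $a_N^\pm$, quantum ergodicity at scale $r=(\log N)^{-\alpha}$ holds for $N\in\mathbb N$: for every choice, for each $N$, of an eigenbasis $\{\phi_j\}_{j=1}^N$ of $\hat M$ in $\mathcal H_N$ there are subsets $S(N)\subseteq\{1,\dots,N\}$ with $\#S(N)/N\to1$ such that $$\langle\mathrm{Op}_N(b^\pm_{x,r})\phi_j,\phi_j\rangle=\mathrm{Vol}(B_2(x,r))+o(r^2)\qquad(N\to\infty),$$ for both signs, uniformly in $j\in S(N)$ and $x\in\mathbb T^2$. -/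

import Mathlib

open Filter Topology MeasureTheory Asymptotics
open scoped SchwartzMap FourierTransform MatrixGroups

noncomputable section

namespace QuantumCat

/-! ### Quantum mechanics on the line

`h > 0` is the Planck constant. Operators are given on Schwartz functions and are extended to
tempered distributions by transposition with respect to the bilinear pairing `∫ u f`. -/

theorem hasTemperateGrowth_expI :
    Function.HasTemperateGrowth (fun x : ℝ => Complex.exp (Complex.I * (x : ℂ))) := by
  have hc : ∀ m : WithTop ℕ∞,
      ContDiff ℝ m (fun x : ℝ => Complex.exp (Complex.I * (x : ℂ))) := fun m =>
    (contDiff_const.mul Complex.ofRealCLM.contDiff).cexp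
  have hd : ∀ n : ℕ, iteratedDeriv n (fun x : ℝ => Complex.exp (Complex.I * (x : ℂ))) =
      fun x : ℝ => Complex.I ^ n * Complex.exp (Complex.I * (x : ℂ)) := by
    intro n
    induction n with
    | zero => simp
    | succ n ih =>
      rw [iteratedDeriv_succ, ih]
      funext x
      have h1 : HasDerivAt (fun x : ℝ => Complex.I * (x : ℂ)) Complex.I x := by
        simpa using (Complex.ofRealCLM.hasDerivAt (x := x)).const_mul Complex.I
      rw [(h1.cexp.const_mul (Complex.I ^ n)).deriv]
      ring
  refine ⟨hc _, fun n => ⟨0, 1, fun x => ?_⟩⟩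
  rw [norm_iteratedFDeriv_eq_norm_iteratedDeriv, hd]
  simp [Complex.norm_exp]

theorem hasTemperateGrowth_expI_comp {g : ℝ → ℝ} (hg : g.HasTemperateGrowth) :
    Function.HasTemperateGrowth (fun x : ℝ => Complex.exp (Complex.I * (g x : ℂ))) :=
  hasTemperateGrowth_expI.comp hg

/-- Multiplication of a Schwartz function by the unimodular function `q ↦ e^{i g(q)}`. -/
def mulPhase (g : ℝ → ℝ) : 𝓢(ℝ, ℂ) →L[ℂ] 𝓢(ℝ, ℂ) :=
  SchwartzMap.smulLeftCLM ℂ (fun q : ℝ => Complex.exp (Complex.I * (g q : ℂ)))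

theorem mulPhase_apply {g : ℝ → ℝ} (hg : g.HasTemperateGrowth) (f : 𝓢(ℝ, ℂ)) (q : ℝ) :
    mulPhase g f q = Complex.exp (Complex.I * (g q : ℂ)) * f q := by
  simp [mulPhase, SchwartzMap.smulLeftCLM_apply_apply (hasTemperateGrowth_expI_comp hg)]

/-- The dilation `f ↦ f (s ·)`, for `s ≠ 0` (and `0` for `s = 0`). -/
def dilation (s : ℝ) : 𝓢(ℝ, ℂ) →L[ℂ] 𝓢(ℝ, ℂ) :=
  if hs : s ≠ 0 then
    SchwartzMap.compCLMOfContinuousLinearEquiv ℂ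
      (ContinuousLinearEquiv.unitsEquivAut ℝ (Units.mk0 s hs))
  else 0

theorem dilation_apply {s : ℝ} (hs : s ≠ 0) (f : 𝓢(ℝ, ℂ)) (q : ℝ) :
    dilation s f q = f (s * q) := by
  simp [dilation, hs, mul_comm]

/-- The phase space translation `T̂_v = exp(-(2πi/h)(v₁ p̂ - v₂ q̂))`, that is
`(T̂_v f)(q) = e^{(2πi/h) v₂ (q - v₁/2)} f(q - v₁)`. -/
def translation (h : ℝ) (v : ℝ × ℝ) : 𝓢(ℝ, ℂ) →L[ℂ] 𝓢(ℝ, ℂ) :=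
  mulPhase (fun q => 2 * Real.pi / h * v.2 * (q - v.1 / 2)) ∘L SchwartzMap.compSubConstCLM ℂ v.1

theorem translation_apply (h : ℝ) (v : ℝ × ℝ) (f : 𝓢(ℝ, ℂ)) (q : ℝ) :
    translation h v f q =
      Complex.exp (Complex.I * ((2 * Real.pi / h * v.2 * (q - v.1 / 2) : ℝ) : ℂ)) * f (q - v.1) := by
  rw [translation, ContinuousLinearMap.comp_apply, mulPhase_apply (by fun_prop)]
  rfl

/-- `T̂_v` on tempered distributions; the transpose of `T̂_{(v₁, v₂)}` is `T̂_{(-v₁, v₂)}`. -/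
def translationDist (h : ℝ) (v : ℝ × ℝ) : 𝓢'(ℝ, ℂ) →L[ℂ] 𝓢'(ℝ, ℂ) :=
  PointwiseConvergenceCLM.precomp ℂ (translation h (-v.1, v.2))

/-- For a quadratic Hamiltonian `H = ½ α q² + ½ β p² + γ q p` whose flow at time one is the linear
map `(q, p) ↦ (A q + B p, C q + D p)` of determinant one with `B ≠ 0`, this is the integral kernel
of the propagator `e^{-2πi Ĥ/h}`:
`(i h B)^{-1/2} exp((πi/(hB)) (D q² - 2 q q' + A q'²))`. -/
def kernel (h A B D q q' : ℝ) : ℂ :=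
  (1 / (Complex.I * h * B)) ^ (1 / 2 : ℂ) *
    Complex.exp (Complex.I * ((Real.pi / (h * B) * (D * q ^ 2 - 2 * q * q' + A * q' ^ 2) : ℝ) : ℂ))

/-- The operator with integral kernel `kernel h A B D` on Schwartz functions
(see `metaplectic_apply`). -/
def metaplectic (h A B D : ℝ) : 𝓢(ℝ, ℂ) →L[ℂ] 𝓢(ℝ, ℂ) :=
  ((1 / (Complex.I * h * B)) ^ (1 / 2 : ℂ)) •
    (mulPhase (fun q => Real.pi / (h * B) * D * q ^ 2) ∘L dilation (1 / (h * B)) ∘L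
      FourierTransform.fourierCLM ℂ 𝓢(ℝ, ℂ) ∘L mulPhase (fun q => Real.pi / (h * B) * A * q ^ 2))

theorem metaplectic_apply {h B : ℝ} (hh : h ≠ 0) (hB : B ≠ 0) (A D : ℝ) (f : 𝓢(ℝ, ℂ)) (q : ℝ) :
    metaplectic h A B D f q = ∫ q' : ℝ, kernel h A B D q q' * f q' := by
  have hs : 1 / (h * B) ≠ 0 := by positivity
  simp only [metaplectic, smul_apply, ContinuousLinearMap.comp_apply]
  rw [mulPhase_apply (by fun_prop), dilation_apply hs, FourierTransform.fourierCLM_apply,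
    SchwartzMap.fourier_coe, Real.fourier_real_eq_integral_exp_smul, ← integral_const_mul,
    smul_eq_mul, ← integral_const_mul]
  refine integral_congr_ae (Eventually.of_forall fun q' => ?_)
  simp only [smul_eq_mul]
  rw [mulPhase_apply (by fun_prop), kernel]
  have e : Complex.exp (Complex.I *
      ((Real.pi / (h * B) * (D * q ^ 2 - 2 * q * q' + A * q' ^ 2) : ℝ) : ℂ)) =
      Complex.exp (Complex.I * ((Real.pi / (h * B) * D * q ^ 2 : ℝ) : ℂ)) *
      (Complex.exp (((-2 * Real.pi * q' * (1 / (h * B) * q) : ℝ) : ℂ) * Complex.I) *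
      Complex.exp (Complex.I * ((Real.pi / (h * B) * A * q' ^ 2 : ℝ) : ℂ))) := by
    rw [← Complex.exp_add, ← Complex.exp_add]
    congr 1
    push_cast
    ring
  rw [e]
  ring

/-- The Weyl quantization `Ĥ = ½ α q̂² + ½ β p̂² + ½ γ (q̂ p̂ + p̂ q̂)` of
`H = ½ α q² + ½ β p² + γ q p`, where `q̂` is multiplication by `q` and `p̂ = (h/(2πi)) d/dq`. -/
def hamiltonian (h α β γ : ℝ) (u : ℝ → ℂ) : ℝ → ℂ :=
  let Q : (ℝ → ℂ) → ℝ → ℂ := fun w q => (q : ℂ) * w q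
  let P : (ℝ → ℂ) → ℝ → ℂ := fun w q => (h : ℂ) / (2 * Real.pi * Complex.I) * deriv w q
  fun q => 1 / 2 * α * Q (Q u) q + 1 / 2 * β * P (P u) q + γ / 2 * (Q (P u) q + P (Q u) q)

/-- Along the Hamiltonian flow `M(t) = (A B; C D)`, `M' = (γ β; -α -γ) M`, the kernel solves the
Schrödinger equation `(ih/2π) ∂ₜ K = Ĥ K`. -/
theorem kernel_schrodinger {h α β γ : ℝ} (hh : 0 < h) {A B C D : ℝ → ℝ}
    (hA : ∀ t, HasDerivAt A (γ * A t + β * C t) t) (hB : ∀ t, HasDerivAt B (γ * B t + β * D t) t)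
    (hD : ∀ t, HasDerivAt D (-α * B t - γ * D t) t) (hdet : ∀ t, A t * D t - B t * C t = 1)
    {t : ℝ} (ht : B t ≠ 0) (q q' : ℝ) :
    Complex.I * h / (2 * Real.pi) * deriv (fun s => kernel h (A s) (B s) (D s) q q') t =
      hamiltonian h α β γ (fun x => kernel h (A t) (B t) (D t) x q') q := by
  have hπ : (Real.pi : ℂ) ≠ 0 := by exact_mod_cast Real.pi_ne_zero
  have hhC : (h : ℂ) ≠ 0 := by exact_mod_cast hh.ne'
  have hBC : (B t : ℂ) ≠ 0 := by exact_mod_cast ht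
  have hI := Complex.I_ne_zero
  have hI2 := Complex.I_sq
  set c : ℝ → ℂ := fun s => 1 / (Complex.I * h * B s) with hc
  have hcne : c t ≠ 0 := by simp [hc, hhC, hBC]
  have hslit : c t ∈ Complex.slitPlane := by
    refine Or.inr ?_
    have : c t = ((-(1 / (h * B t)) : ℝ) : ℂ) * Complex.I := by
      simp only [hc]
      push_cast
      field_simp
      rw [hI2]
      norm_num
    rw [this, Complex.im_ofReal_mul, Complex.I_im, mul_one]
    have : h * B t ≠ 0 := mul_ne_zero hh.ne' ht
    exact neg_ne_zero.2 (one_div_ne_zero this)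
  have hBd : HasDerivAt (fun s => (B s : ℂ)) ((γ * B t + β * D t : ℝ) : ℂ) t := (hB t).ofReal_comp
  have hcd : HasDerivAt c (-c t * ((γ * B t + β * D t : ℝ) : ℂ) / B t) t := by
    have h1 := ((hBd.const_mul (Complex.I * h)).inv (by simp [hhC, hBC]))
    have h2 : c = (fun s => Complex.I * h * (B s : ℂ))⁻¹ := by
      funext s
      simp [hc]
    rw [h2]
    refine h1.congr_deriv ?_
    simp only [Pi.inv_apply]
    field_simp
  have hw : HasDerivAt (fun s => c s ^ (1 / 2 : ℂ))
      (-(1 / 2) * c t ^ (1 / 2 : ℂ) * ((γ * B t + β * D t : ℝ) : ℂ) / B t) t := by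
    have h1 := (Complex.hasStrictDerivAt_cpow_const (c := (1 / 2 : ℂ)) hslit).hasDerivAt.comp t hcd
    refine h1.congr_deriv ?_
    rw [Complex.cpow_sub _ _ hcne, Complex.cpow_one]
    field_simp
  have hEt : HasDerivAt
      (fun s => Real.pi / (h * B s) * (D s * q ^ 2 - 2 * q * q' + A s * q' ^ 2))
      (-(Real.pi * (γ * B t + β * D t) / (h * B t ^ 2)) *
          (D t * q ^ 2 - 2 * q * q' + A t * q' ^ 2) +
        Real.pi / (h * B t) *
          ((-α * B t - γ * D t) * q ^ 2 + (γ * A t + β * C t) * q' ^ 2)) t := by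
    have h1 := ((((hB t).const_mul h).inv (mul_ne_zero hh.ne' ht)).const_mul Real.pi).mul
      ((((hD t).mul_const (q ^ 2)).sub_const (2 * q * q')).add ((hA t).mul_const (q' ^ 2)))
    refine (h1.congr_deriv ?_).congr_of_eventuallyEq (Eventually.of_forall fun s => ?_)
    · simp only [Pi.inv_apply, Pi.add_apply]
      field_simp
    · simp [div_eq_mul_inv]
  have hKt := hw.mul (hEt.ofReal_comp.const_mul Complex.I).cexp
  set K : ℝ → ℂ := fun x => kernel h (A t) (B t) (D t) x q' with hK
  have hKq : ∀ x : ℝ, HasDerivAt K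
      (Complex.I * (2 * Real.pi / (h * B t) * (D t * x - q')) * K x) x := by
    intro x
    have h1 : HasDerivAt
        (fun x : ℝ => Real.pi / (h * B t) * (D t * x ^ 2 - 2 * x * q' + A t * q' ^ 2))
        (2 * Real.pi / (h * B t) * (D t * x - q')) x := by
      have h2 := (((((hasDerivAt_id x).pow 2).const_mul (D t)).sub
        (((hasDerivAt_id x).const_mul 2).mul_const q')).add_const (A t * q' ^ 2)).const_mul
          (Real.pi / (h * B t))
      refine h2.congr_deriv ?_
      simp
      ring
    have h3 := ((h1.ofReal_comp.const_mul Complex.I).cexp).const_mul (c t ^ (1 / 2 : ℂ))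
    refine h3.congr_deriv ?_
    simp only [hK, kernel, hc]
    push_cast
    ring
  have hP : (fun x : ℝ => (h : ℂ) / (2 * Real.pi * Complex.I) * deriv K x) =
      fun x : ℝ => (1 / B t * (D t * x - q') : ℂ) * K x := by
    funext x
    rw [(hKq x).deriv]
    field_simp
  have hPP : deriv (fun x : ℝ => (1 / B t * (D t * x - q') : ℂ) * K x) q =
      (D t / B t : ℂ) * K q + (1 / B t * (D t * q - q') : ℂ) *
        (Complex.I * (2 * Real.pi / (h * B t) * (D t * q - q')) * K q) := by
    have h1 : HasDerivAt (fun x : ℝ => (1 / B t * (D t * x - q') : ℂ)) (D t / B t : ℂ) q := by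
      have h2 := (((Complex.ofRealCLM.hasDerivAt (x := q)).const_mul (D t : ℂ)).sub_const
        (q' : ℂ)).const_mul (1 / B t : ℂ)
      refine h2.congr_deriv ?_
      simp
      ring
    exact (h1.mul (hKq q)).deriv
  have hPQ : deriv (fun x : ℝ => (x : ℂ) * K x) q =
      K q + q * (Complex.I * (2 * Real.pi / (h * B t) * (D t * q - q')) * K q) := by
    have h1 : HasDerivAt (fun x : ℝ => (x : ℂ)) 1 q := Complex.ofRealCLM.hasDerivAt
    exact (h1.mul (hKq q)).deriv.trans (by rw [one_mul])
  have hdetC : (A t : ℂ) * D t - B t * C t = 1 := by exact_mod_cast hdet t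
  have hC : (C t : ℂ) = (A t * D t - 1) / B t := by
    field_simp
    linear_combination -hdetC
  have hKq0 : K q = c t ^ (1 / 2 : ℂ) * Complex.exp (Complex.I *
      ((Real.pi / (h * B t) * (D t * q ^ 2 - 2 * q * q' + A t * q' ^ 2) : ℝ) : ℂ)) := rfl
  have hL := hKt.deriv
  change deriv (fun s => kernel h (A s) (B s) (D s) q q') t = _ at hL
  rw [hL]
  simp only [hamiltonian]
  rw [hP, hPP, hPQ]
  have hPq := congrFun hP q
  rw [hPq]
  rw [hKq0]
  have key : Complex.I * h / (2 * Real.pi) *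
      (-(1 / 2) * ((γ * B t + β * D t : ℝ) : ℂ) / B t + Complex.I *
        ((-(Real.pi * (γ * B t + β * D t) / (h * B t ^ 2)) *
            (D t * q ^ 2 - 2 * q * q' + A t * q' ^ 2) +
          Real.pi / (h * B t) *
            ((-α * B t - γ * D t) * q ^ 2 + (γ * A t + β * C t) * q' ^ 2) : ℝ) : ℂ)) =
      1 / 2 * α * (q * q) + 1 / 2 * β * (h / (2 * Real.pi * Complex.I) *
        (D t / B t + 1 / B t * (D t * q - q') *
          (Complex.I * (2 * Real.pi / (h * B t) * (D t * q - q'))))) +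
      γ / 2 * (q * (1 / B t * (D t * q - q')) + h / (2 * Real.pi * Complex.I) *
        (1 + q * (Complex.I * (2 * Real.pi / (h * B t) * (D t * q - q'))))) := by
    push_cast
    rw [hC]
    field_simp
    ring_nf
    simp only [hI2, show Complex.I ^ 3 = -Complex.I by
      rw [pow_succ, hI2]; ring]
    ring
  linear_combination (c t ^ (1 / 2 : ℂ) * Complex.exp (Complex.I *
      ((Real.pi / (h * B t) * (D t * q ^ 2 - 2 * q * q' + A t * q' ^ 2) : ℝ) : ℂ))) * key

/-- The quantization `M̂` of `M = (A B; C D) ∈ SL(2, ℤ)` with `B ≠ 0` (which holds for every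
hyperbolic `M`), at Planck constant `h`, acting on tempered distributions. The transpose of the
operator with kernel `K(q, q')` has kernel `K(q', q)`, which exchanges `A` and `D`. For trace `> 2` this is
`e^{-2πi Ĥ/h}`; for trace `< -2` it is, up to a phase, that propagator for `-M` followed by the
parity `q ↦ -q`. -/
def quantization (h : ℝ) (M : SL(2, ℤ)) : 𝓢'(ℝ, ℂ) →L[ℂ] 𝓢'(ℝ, ℂ) :=
  PointwiseConvergenceCLM.precomp ℂ (metaplectic h (M 1 1) (M 0 1) (M 0 0))

/-! ### Quantum states on the torus -/

/-- The space `H_{N,κ}`, described by the coefficients `Ψ` of the distributions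
`∑ₖ Ψ(k) δ(q - (k + κ₁)/N)`; these satisfy `Ψ(k + N) = e^{-2πi κ₂} Ψ(k)`. -/
def State (N : ℕ) (κ : ℝ × ℝ) : Submodule ℂ (ℤ → ℂ) where
  carrier := {Ψ | ∀ k : ℤ, Ψ (k + N) = Complex.exp (-2 * Real.pi * Complex.I * κ.2) * Ψ k}
  add_mem' := by
    intro a b ha hb k
    simp only [Pi.add_apply, ha k, hb k]
    ring
  zero_mem' := by
    intro k
    simp
  smul_mem' := by
    intro c a ha k
    simp only [Pi.smul_apply, smul_eq_mul, ha k]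
    ring

theorem exists_bound {N : ℕ} (hN : 0 < N) {κ : ℝ × ℝ} (Ψ : State N κ) :
    ∃ C : ℝ, 0 ≤ C ∧ ∀ k : ℤ, ‖(Ψ : ℤ → ℂ) k‖ ≤ C := by
  have hper : Function.Periodic (fun k : ℤ => ‖(Ψ : ℤ → ℂ) k‖) (N : ℤ) := by
    intro k
    have h1 : ‖Complex.exp (-2 * Real.pi * Complex.I * κ.2)‖ = 1 := by
      simp [Complex.norm_exp]
    simp only [Ψ.2 k, norm_mul, h1, one_mul]
  refine ⟨∑ i ∈ Finset.range N, ‖(Ψ : ℤ → ℂ) i‖,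
    Finset.sum_nonneg fun _ _ => norm_nonneg _, fun k => ?_⟩
  have hN' : (0 : ℤ) < N := by exact_mod_cast hN
  have h0 : 0 ≤ k % (N : ℤ) := Int.emod_nonneg _ hN'.ne'
  have h2 : k % (N : ℤ) < N := Int.emod_lt_of_pos _ hN'
  have h3 : ‖(Ψ : ℤ → ℂ) k‖ = ‖(Ψ : ℤ → ℂ) ((k % (N : ℤ)).toNat : ℤ)‖ := by
    rw [Int.toNat_of_nonneg h0]
    have := hper.int_mul (k / (N : ℤ)) (k % (N : ℤ))
    rw [← this]
    congr 2
    have := Int.emod_add_mul_ediv k N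
    rw [Int.cast_id, mul_comm (k / (N : ℤ)), this]
  rw [h3]
  exact Finset.single_le_sum (f := fun i : ℕ => ‖(Ψ : ℤ → ℂ) (i : ℤ)‖)
    (fun _ _ => norm_nonneg _) (Finset.mem_range.2 (by omega))

theorem summable_lattice {N : ℕ} (hN : 0 < N) (κ : ℝ) :
    Summable fun k : ℤ => ((1 + |((k : ℝ) + κ) / N|) ^ 2)⁻¹ := by
  have hN' : (0 : ℝ) < N := by exact_mod_cast hN
  have h := ((Real.summable_one_div_int_add_rpow κ 2).2 (by norm_num)).mul_left ((N : ℝ) ^ 2)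
  refine h.of_norm_bounded_eventually ?_
  have hfin : {k : ℤ | (k : ℝ) + κ = 0}.Finite := by
    refine Set.Subsingleton.finite fun a ha b hb => ?_
    have : (a : ℝ) = b := by
      simp only [Set.mem_ofPred_eq] at ha hb
      linarith
    exact_mod_cast this
  filter_upwards [hfin.compl_mem_cofinite] with k hk
  have hk' : 0 < |(k : ℝ) + κ| := abs_pos.2 hk
  rw [Real.norm_of_nonneg (by positivity), Real.rpow_two, abs_div, abs_of_pos hN']
  rw [show (N : ℝ) ^ 2 * (1 / |(k : ℝ) + κ| ^ 2) = ((|(k : ℝ) + κ| / N) ^ 2)⁻¹ by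
    field_simp]
  gcongr
  linarith

theorem exists_seminorm_bound (f : 𝓢(ℝ, ℂ)) (x : ℝ) :
    ‖f x‖ ≤ (4 * (Finset.Iic ((2, 0) : ℕ × ℕ)).sup (schwartzSeminormFamily ℂ ℝ ℂ) f) *
      ((1 + |x|) ^ 2)⁻¹ := by
  have h := SchwartzMap.one_add_le_sup_seminorm_apply (𝕜 := ℂ) (m := (2, 0)) (k := 2) (n := 0)
    le_rfl le_rfl f x
  rw [norm_iteratedFDeriv_zero, Real.norm_eq_abs] at h
  rw [← div_eq_mul_inv, le_div_iff₀ (by positivity), mul_comm]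
  calc _ ≤ _ := h
    _ = _ := by norm_num; rfl

theorem summable_state {N : ℕ} (hN : 0 < N) {κ : ℝ × ℝ} (Ψ : State N κ) (f : 𝓢(ℝ, ℂ)) :
    Summable fun k : ℤ => (Ψ : ℤ → ℂ) k * f (((k : ℝ) + κ.1) / N) := by
  obtain ⟨C, hC, hb⟩ := exists_bound hN Ψ
  refine (((summable_lattice hN κ.1).mul_left
    (4 * (Finset.Iic ((2, 0) : ℕ × ℕ)).sup (schwartzSeminormFamily ℂ ℝ ℂ) f)).mul_left
      C).of_norm_bounded fun k => ?_
  rw [norm_mul]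
  exact mul_le_mul (hb k) (exists_seminorm_bound f _) (norm_nonneg _) hC

/-- The tempered distribution `∑ₖ Ψ(k) δ(q - (k + κ₁)/N)` (only used for `N ≥ 1`). -/
def toDist {N : ℕ} {κ : ℝ × ℝ} (Ψ : State N κ) : 𝓢'(ℝ, ℂ) :=
  ContinuousLinearMap.toPointwiseConvergenceCLM _ _ _ _ <|
    SchwartzMap.mkCLMtoNormedSpace (𝕜 := ℂ) (σ := RingHom.id ℂ)
      (fun f : 𝓢(ℝ, ℂ) => if 0 < N then
        ∑' k : ℤ, (Ψ : ℤ → ℂ) k * f (((k : ℝ) + κ.1) / N) else 0)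
      (by
        intro f g
        split_ifs with hN
        · rw [← (summable_state hN Ψ f).tsum_add (summable_state hN Ψ g)]
          simp [mul_add]
        · simp)
      (by
        intro c f
        split_ifs with hN
        · simp only [RingHom.id_apply, smul_eq_mul, ← tsum_mul_left]
          refine tsum_congr fun k => ?_
          simp only [smul_apply, smul_eq_mul]
          ring
        · simp)
      (by
        by_cases hN : 0 < N
        · obtain ⟨C, hC, hb⟩ := exists_bound hN Ψ
          have hs := summable_lattice hN κ.1
          refine ⟨Finset.Iic (2, 0), C * (4 * ∑' k : ℤ, ((1 + |((k : ℝ) + κ.1) / N|) ^ 2)⁻¹),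
            mul_nonneg hC (mul_nonneg (by norm_num) (tsum_nonneg fun k => by positivity)),
            fun f => ?_⟩
          rw [if_pos hN]
          refine (tsum_of_norm_bounded ((hs.mul_left
            (4 * (Finset.Iic ((2, 0) : ℕ × ℕ)).sup (schwartzSeminormFamily ℂ ℝ ℂ) f)).mul_left
              C).hasSum fun k => ?_).trans (le_of_eq ?_)
          · rw [norm_mul]
            exact mul_le_mul (hb k) (exists_seminorm_bound f _) (norm_nonneg _) hC
          · rw [tsum_mul_left, tsum_mul_left]
            ring
        · exact ⟨∅, 0, le_rfl, fun f => by simp [hN]⟩)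

theorem toDist_apply {N : ℕ} (hN : 0 < N) {κ : ℝ × ℝ} (Ψ : State N κ) (f : 𝓢(ℝ, ℂ)) :
    toDist Ψ f = ∑' k : ℤ, (Ψ : ℤ → ℂ) k * f (((k : ℝ) + κ.1) / N) :=
  if_pos hN

/-- The inner product `⟨ψ, φ⟩ = (1/N) ∑_{k=1}^N Ψ(k) conj Φ(k)` of `H_{N,κ}`. -/
def stateInner {N : ℕ} {κ : ℝ × ℝ} (Ψ Φ : State N κ) : ℂ :=
  1 / N * ∑ k ∈ Finset.Icc 1 N, (Ψ : ℤ → ℂ) k * (starRingEnd ℂ) ((Φ : ℤ → ℂ) k)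

/-- The translation `T̂_N(n) = T̂_{n/N}` at `h = 1/N` on `H_{N,κ}`, in terms of coefficients
(see `toDist_translationN`). -/
def translationN (N : ℕ) (κ : ℝ × ℝ) (n : ℤ × ℤ) : State N κ →ₗ[ℂ] State N κ where
  toFun Ψ := ⟨fun k => Complex.exp (2 * Real.pi * Complex.I *
      (n.2 * (k + κ.1 - n.1 / 2) / N)) * (Ψ : ℤ → ℂ) (k - n.1), by
    intro k
    have h1 : k + (N : ℤ) - n.1 = k - n.1 + N := by ring
    simp only [h1, Ψ.2 (k - n.1)]
    rcases Nat.eq_zero_or_pos N with hN | hN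
    · subst hN
      simp
    have hN' : (N : ℂ) ≠ 0 := by exact_mod_cast hN.ne'
    have h2 : 2 * Real.pi * Complex.I * (n.2 * (((k + (N : ℤ) : ℤ) : ℂ) + κ.1 - n.1 / 2) / N) =
        2 * Real.pi * Complex.I * (n.2 * (k + κ.1 - n.1 / 2) / N) +
          n.2 * (2 * Real.pi * Complex.I) := by
      push_cast
      field_simp
      ring
    rw [h2, Complex.exp_add, Complex.exp_int_mul_two_pi_mul_I]
    ring⟩
  map_add' Ψ Φ := by
    ext k
    simp [mul_add]
  map_smul' c Ψ := by
    ext k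
    simp only [SetLike.val_smul, Pi.smul_apply, smul_eq_mul, RingHom.id_apply]
    ring

theorem toDist_translationN {N : ℕ} (hN : 0 < N) {κ : ℝ × ℝ} (n : ℤ × ℤ) (Ψ : State N κ) :
    toDist (translationN N κ n Ψ) =
      translationDist (1 / N) ((n.1 : ℝ) / N, (n.2 : ℝ) / N) (toDist Ψ) := by
  have hN' : (N : ℝ) ≠ 0 := by exact_mod_cast hN.ne'
  ext f
  change _ = toDist Ψ (translation (1 / N) (-((n.1 : ℝ) / N), (n.2 : ℝ) / N) f)
  rw [toDist_apply hN, toDist_apply hN, ← (Equiv.addRight n.1).tsum_eq]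
  refine tsum_congr fun k => ?_
  rw [translation_apply]
  simp only [translationN, LinearMap.coe_mk, AddHom.coe_mk, Equiv.coe_addRight,
    add_sub_cancel_right]
  have h1 : (((k + n.1 : ℤ) : ℝ) + κ.1) / N = ((k : ℝ) + κ.1) / N - -((n.1 : ℝ) / N) := by
    push_cast
    field_simp
    ring
  have h2 : 2 * Real.pi * Complex.I * (n.2 * (((k + n.1 : ℤ) : ℂ) + κ.1 - n.1 / 2) / N) =
      Complex.I * ((2 * Real.pi / (1 / (N : ℝ)) * ((n.2 : ℝ) / N) *
        (((k : ℝ) + κ.1) / N - -((n.1 : ℝ) / N) / 2) : ℝ) : ℂ) := by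
    have hNC : (N : ℂ) ≠ 0 := by exact_mod_cast hN.ne'
    push_cast
    field_simp
    ring
  rw [h1, h2]
  ring

/-- `{φ_j}` is an eigenbasis of `M̂` in `H_{N,κ}`: `N` orthonormal vectors of this `N`-dimensional
space with `M̂ φ_j = e^{iθ_j} φ_j`. -/
structure IsEigenbasis (M : SL(2, ℤ)) {N : ℕ} {κ : ℝ × ℝ} (φ : Fin N → State N κ) : Prop where
  orthonormal : ∀ i j, stateInner (φ i) (φ j) = if i = j then 1 else 0
  eigen : ∀ j, ∃ θ : ℝ, quantization (1 / N) M (toDist (φ j)) =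
    Complex.exp (Complex.I * θ) • (toDist (φ j))

/-- `M̂` maps `H_{N,κ}` to itself. -/
def PreservesStates (M : SL(2, ℤ)) (N : ℕ) (κ : ℝ × ℝ) : Prop :=
  ∀ Ψ : State N κ, ∃ Φ : State N κ, quantization (1 / N) M (toDist Ψ) = toDist Φ

/-! ### Observables -/

/-- The torus `𝕋² = ℝ²/ℤ²`; its canonical measure has total mass one. -/
abbrev Torus : Type := UnitAddCircle × UnitAddCircle

/-- The open geodesic ball `B₂(x, r)` of the flat torus; the norm of `UnitAddCircle` is the distance
to `0`. -/
def disc (x : Torus) (r : ℝ) : Set Torus :=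
  {y | √(‖y.1 - x.1‖ ^ 2 + ‖y.2 - x.2‖ ^ 2) < r}

/-- Trigonometric polynomials `a(x) = ∑ₙ ã(n) e^{2πi (n ∧ x)}` on `𝕋²`, given by their finitely many
non-zero Fourier coefficients `ã(n)`. -/
abbrev TrigPoly : Type := (ℤ × ℤ) →₀ ℂ

/-- The character `x ↦ e^{2πi (n ∧ x)}`, where `n ∧ x = n₂ x₁ - n₁ x₂`. -/
def character (n : ℤ × ℤ) (x : Torus) : ℂ :=
  fourier n.2 x.1 * fourier (-n.1) x.2

/-- The value `a(x) = ∑ₙ ã(n) e^{2πi (n ∧ x)}`. -/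
def TrigPoly.eval (a : TrigPoly) (x : Torus) : ℂ :=
  a.sum fun n c => c * character n x

/-- The translate `a(· - x)`, with Fourier coefficients `e^{-2πi (n ∧ x)} ã(n)`. -/
def TrigPoly.translate (a : TrigPoly) (x : Torus) : TrigPoly :=
  Finsupp.onFinset a.support (fun n => character n (-x) * a n) fun _ hn =>
    Finsupp.mem_support_iff.2 (right_ne_zero_of_mul hn)

theorem TrigPoly.eval_translate (a : TrigPoly) (x y : Torus) :
    (a.translate x).eval y = a.eval (y - x) := by
  have hch : ∀ n : ℤ × ℤ, character n (-x) * character n y = character n (y - x) := by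
    intro n
    simp only [character, fourier_apply, Prod.fst_neg, Prod.snd_neg,
      sub_eq_neg_add, Prod.fst_add, Prod.snd_add, smul_add, AddCircle.toCircle_add, Circle.coe_mul]
    ring
  have hsub : (a.translate x).support ⊆ a.support := Finsupp.support_onFinset_subset
  rw [TrigPoly.eval, TrigPoly.eval, Finsupp.sum_of_support_subset _ hsub _ (by simp), Finsupp.sum]
  refine Finset.sum_congr rfl fun n _ => ?_
  rw [← hch n]
  simp only [TrigPoly.translate, Finsupp.onFinset_apply]
  ring

/-- The Weyl quantization `Op_N(a) = ∑ₙ ã(n) T̂_N(n)` on `H_{N,κ}`. -/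
def weylOp (N : ℕ) (κ : ℝ × ℝ) (a : TrigPoly) : State N κ →ₗ[ℂ] State N κ :=
  a.sum fun n c => c • translationN N κ n

/-- `(a_N^+)` and `(a_N^-)` are trigonometric majorants and minorants of degree less than `D(N)` of
the indicator functions of the discs `B₂(0, r(N))`: for all large `N` they are real-valued,
`a_N^- ≤ χ_{B₂(0, r)} ≤ a_N^+`, their Fourier coefficients vanish at `|n| ≥ D` and are
bounded by a constant times `r²`, and their integrals are `Vol(B₂(0, r)) + o(r²)`. -/
structure IsMajorantMinorant (r D : ℕ → ℝ) (aPlus aMinus : ℕ → TrigPoly) : Prop where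
  real : ∀ᶠ N in atTop, ∀ y : Torus, ((aPlus N).eval y).im = 0 ∧ ((aMinus N).eval y).im = 0
  majorant : ∀ᶠ N in atTop, ∀ y : Torus,
    (disc 0 (r N)).indicator (fun _ => (1 : ℝ)) y ≤ ((aPlus N).eval y).re
  minorant : ∀ᶠ N in atTop, ∀ y : Torus,
    ((aMinus N).eval y).re ≤ (disc 0 (r N)).indicator (fun _ => (1 : ℝ)) y
  degree : ∀ᶠ N in atTop, ∀ n : ℤ × ℤ, D N ≤ √((n.1 : ℝ) ^ 2 + (n.2 : ℝ) ^ 2) →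
    aPlus N n = 0 ∧ aMinus N n = 0
  coeff : ∃ c : ℝ, ∀ᶠ N in atTop, ∀ n : ℤ × ℤ,
    ‖aPlus N n‖ ≤ c * r N ^ 2 ∧ ‖aMinus N n‖ ≤ c * r N ^ 2
  integral_plus :
    (fun N => aPlus N 0 - (volume.real (disc 0 (r N)) : ℂ)) =o[atTop] fun N => r N ^ 2
  integral_minus :
    (fun N => aMinus N 0 - (volume.real (disc 0 (r N)) : ℂ)) =o[atTop] fun N => r N ^ 2

/-- Quantum ergodicity of the quantum cat map of `M` at scale `r = r(N)`, `N ∈ ℕ`, tested on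
`b^±_{x,r} = a_N^±(· - x)`: for every admissible choice of `κ` and every choice of eigenbases
there are sets `S(N) ⊆ {1, …, N}` of full density such that
`⟨Op_N(b^±_{x,r}) φ_j, φ_j⟩ = Vol(B₂(x, r)) + o(r²)` uniformly in `j ∈ S(N)` and `x ∈ 𝕋²`. -/
def QuantumErgodicityAtScale (M : SL(2, ℤ)) (r : ℕ → ℝ) (aPlus aMinus : ℕ → TrigPoly) : Prop :=
  ∀ κ : ℕ → ℝ × ℝ, (∀ N, 0 < N → PreservesStates M N (κ N)) →
  ∀ φ : (N : ℕ) → Fin N → State N (κ N), (∀ N, 0 < N → IsEigenbasis M (φ N)) →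
  ∃ S : (N : ℕ) → Finset (Fin N),
    Tendsto (fun N => ((S N).card : ℝ) / N) atTop (𝓝 1) ∧
    ∀ ε : ℝ, 0 < ε → ∀ᶠ N in atTop, ∀ j ∈ S N, ∀ x : Torus,
      ‖stateInner (weylOp N (κ N) ((aPlus N).translate x) (φ N j)) (φ N j) -
          (volume.real (disc x (r N)) : ℂ)‖ ≤ ε * r N ^ 2 ∧
      ‖stateInner (weylOp N (κ N) ((aMinus N).translate x) (φ N j)) (φ N j) -
          (volume.real (disc x (r N)) : ℂ)‖ ≤ ε * r N ^ 2

end QuantumCat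

end

/-! The core is a second-moment estimate for one translation T̂_N(n), n ≠ 0, over an eigenbasis. The
quantization of a linear map satisfies an exact Egorov identity (`quantization_translationDist`), so
the diagonal matrix elements of T̂_N(n) are constant along the orbit of n under M
(`IsEigenbasis.stateInner_latticeMap`). Averaging over T orbit points and applying Cauchy–Schwarz
bounds their total square by T⁻² times a sum of traces of translations by differences of orbit
points. Such a trace vanishes unless the difference is 0 modulo N (`trace_translationN`), which
leaves N/T (`IsEigenbasis.sum_norm_sq_le`). Hyperbolicity makes the orbit points distinct; their
growth is at most exponential, so they remain distinct modulo N for T of order log N. The variance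
is therefore O(1/log N) (`exists_variance_bound`).

An admissible observable has O(D²) modes with coefficients O(r²). Cauchy–Schwarz over the modes
gives mean square O(D⁴/log N) = o(1) for the sum of the absolute matrix elements, and Chebyshev
yields a set of indices of full density. Translating the observable by x changes only phases of
coefficients, so one set serves every x and both signs
(`IsMajorantMinorant.quantumErgodicityAtScale`).

Admissible polynomials arise by convolution with a non-negative trigonometric kernel of mass one,
degree below D and fourth moment O(D⁻⁴) (`exists_kernel`). For the majorant, a slightly enlarged
disc is smoothed and rescaled. For the minorant, the smoothed shrunken disc has a tail outside the
disc; it is cancelled by subtracting a small multiple of a smoothed weight that dominates (r/|x|)⁴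
there (`integral_lowerProfile_le_indicator`). With relative margin ε = (rD)^(-1/2) all losses are
o(r²). -/

noncomputable section

namespace QuantumCat

/-! ### Weyl translations, inner product and traces on the state space. -/

section Algebra

variable {N : ℕ} {κ : ℝ × ℝ}

theorem translationN_apply (n : ℤ × ℤ) (Ψ : State N κ) (k : ℤ) :
    (translationN N κ n Ψ : ℤ → ℂ) k = Complex.exp (2 * Real.pi * Complex.I *
      (n.2 * (k + κ.1 - n.1 / 2) / N)) * (Ψ : ℤ → ℂ) (k - n.1) := rfl

theorem translationN_zero : translationN N κ 0 = 1 := by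
  ext Ψ k
  simp [translationN_apply]

/-- The phase in the composition law of the translations. -/
def weylPhase (N : ℕ) (m n : ℤ × ℤ) : ℂ :=
  Complex.exp (2 * Real.pi * Complex.I * ((m.2 * n.1 - m.1 * n.2) / (2 * N)))

theorem translationN_mul (m n : ℤ × ℤ) :
    translationN N κ m * translationN N κ n = weylPhase N m n • translationN N κ (m + n) := by
  rcases Nat.eq_zero_or_pos N with hN | hN
  · subst hN
    ext Ψ k
    simp [translationN_apply, weylPhase, sub_sub]
  have hN' : (N : ℂ) ≠ 0 := by exact_mod_cast hN.ne'
  ext Ψ k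
  simp only [Module.End.mul_apply, LinearMap.smul_apply, SetLike.val_smul, Pi.smul_apply,
    translationN_apply, smul_eq_mul, ← mul_assoc, weylPhase, ← Complex.exp_add, sub_sub,
    Prod.fst_add, Prod.snd_add]
  congr 2
  push_cast
  field_simp
  ring

theorem translationN_mul_neg (n : ℤ × ℤ) : translationN N κ n * translationN N κ (-n) = 1 := by
  rw [translationN_mul, add_neg_cancel, translationN_zero, weylPhase]
  simp only [Prod.fst_neg, Prod.snd_neg, Int.cast_neg]
  rw [show ((n.2 : ℂ) * -(n.1 : ℂ) - n.1 * -(n.2 : ℂ)) = 0 by ring]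
  simp

/-- Translations commute up to a phase, so conjugation acts on each of them by a scalar. This scalar
forces most traces to vanish. -/
theorem translationN_mul_mul_neg (m n : ℤ × ℤ) :
    translationN N κ m * translationN N κ n * translationN N κ (-m) =
      (weylPhase N m n * weylPhase N (m + n) (-m)) • translationN N κ n := by
  rw [translationN_mul, smul_mul_assoc, translationN_mul, smul_smul, add_neg_cancel_comm]

/-- Restriction of the coefficients to one period. -/
def restrict (N : ℕ) (κ : ℝ × ℝ) : State N κ →ₗ[ℂ] (Fin N → ℂ) where
  toFun Ψ i := (Ψ : ℤ → ℂ) (i : ℕ)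
  map_add' _ _ := rfl
  map_smul' _ _ := rfl

theorem norm_apply_add (Ψ : State N κ) (k : ℤ) : ‖(Ψ : ℤ → ℂ) (k + N)‖ = ‖(Ψ : ℤ → ℂ) k‖ := by
  have h1 : ‖Complex.exp (-2 * Real.pi * Complex.I * κ.2)‖ = 1 := by
    simp [Complex.norm_exp]
  rw [Ψ.2 k, norm_mul, h1, one_mul]

theorem norm_apply_emod (Ψ : State N κ) (k : ℤ) :
    ‖(Ψ : ℤ → ℂ) (k % N)‖ = ‖(Ψ : ℤ → ℂ) k‖ := by
  have hper : Function.Periodic (fun k : ℤ => ‖(Ψ : ℤ → ℂ) k‖) (N : ℤ) := norm_apply_add Ψ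
  have := hper.int_mul (k / (N : ℤ)) (k % (N : ℤ))
  refine this.symm.trans ?_
  congr 2
  have := Int.emod_add_mul_ediv k N
  rw [Int.cast_id, mul_comm (k / (N : ℤ)), this]

/-- Quasi-periodicity changes a coefficient by a unimodular factor, so vanishing on one period
propagates through absolute values alone. -/
theorem restrict_injective (hN : 0 < N) : Function.Injective (restrict N κ) := by
  rw [← LinearMap.ker_eq_bot, LinearMap.ker_eq_bot']
  intro Ψ h
  ext k
  have hN' : (0 : ℤ) < N := by exact_mod_cast hN
  have h0 : 0 ≤ k % (N : ℤ) := Int.emod_nonneg _ hN'.ne'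
  have h2 : k % (N : ℤ) < N := Int.emod_lt_of_pos _ hN'
  have h3 := congrFun h ⟨(k % (N : ℤ)).toNat, by omega⟩
  simp only [restrict, LinearMap.coe_mk, AddHom.coe_mk, Int.toNat_of_nonneg h0,
    Pi.zero_apply] at h3
  have h4 := norm_apply_emod Ψ k
  rw [h3, norm_zero] at h4
  exact norm_eq_zero.1 h4.symm

theorem finiteDimensional_state (hN : 0 < N) : FiniteDimensional ℂ (State N κ) :=
  FiniteDimensional.of_injective _ (restrict_injective hN)

/-- An upper bound on the dimension suffices: N orthonormal vectors supply the reverse inequality.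
-/
theorem finrank_state_le (hN : 0 < N) : Module.finrank ℂ (State N κ) ≤ N := by
  have := LinearMap.finrank_le_finrank_of_injective (restrict_injective (κ := κ) hN)
  simpa using this

theorem stateInner_sum_left {ι : Type*} (s : Finset ι) (c : ι → ℂ) (f : ι → State N κ)
    (Φ : State N κ) :
    stateInner (∑ i ∈ s, c i • f i) Φ = ∑ i ∈ s, c i * stateInner (f i) Φ := by
  simp only [stateInner, Submodule.coe_sum, SetLike.val_smul, Finset.sum_apply, Pi.smul_apply,
    smul_eq_mul, Finset.sum_mul, Finset.mul_sum]
  rw [Finset.sum_comm]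
  refine Finset.sum_congr rfl fun i _ => Finset.sum_congr rfl fun k _ => ?_
  ring

theorem stateInner_smul_left (c : ℂ) (Ψ Φ : State N κ) :
    stateInner (c • Ψ) Φ = c * stateInner Ψ Φ := by
  simpa using stateInner_sum_left {()} (fun _ => c) (fun _ => Ψ) Φ

theorem stateInner_conj (Ψ Φ : State N κ) :
    (starRingEnd ℂ) (stateInner Ψ Φ) = stateInner Φ Ψ := by
  simp [stateInner, mul_comm]

theorem stateInner_sum_right {ι : Type*} (s : Finset ι) (f : ι → State N κ) (Ψ : State N κ) :
    stateInner Ψ (∑ i ∈ s, f i) = ∑ i ∈ s, stateInner Ψ (f i) := by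
  rw [← stateInner_conj]
  have := stateInner_sum_left s (fun _ => 1) f Ψ
  simp only [one_smul, one_mul] at this
  rw [this, map_sum]
  simp [stateInner_conj]

theorem stateInner_sum {ι : Type*} (s : Finset ι) (f : ι → State N κ) (Φ : State N κ) :
    stateInner (∑ i ∈ s, f i) Φ = ∑ i ∈ s, stateInner (f i) Φ := by
  simpa using stateInner_sum_left s (fun _ => 1) f Φ

/-- Cauchy–Schwarz. -/
theorem norm_sq_stateInner_le (Ψ Φ : State N κ) :
    ‖stateInner Ψ Φ‖ ^ 2 ≤ (stateInner Ψ Ψ).re * (stateInner Φ Φ).re := by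
  have hre : ∀ Ψ : State N κ, (stateInner Ψ Ψ).re =
      1 / N * ∑ k ∈ Finset.Icc 1 N, ‖(Ψ : ℤ → ℂ) k‖ ^ 2 := by
    intro Ψ
    have : stateInner Ψ Ψ = ((1 / N * ∑ k ∈ Finset.Icc 1 N, ‖(Ψ : ℤ → ℂ) k‖ ^ 2 : ℝ) : ℂ) := by
      simp only [stateInner, Complex.mul_conj, Complex.normSq_eq_norm_sq]
      push_cast
      rfl
    rw [this, Complex.ofReal_re]
  have h1 : ‖∑ k ∈ Finset.Icc 1 N, (Ψ : ℤ → ℂ) k * (starRingEnd ℂ) ((Φ : ℤ → ℂ) k)‖ ≤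
      ∑ k ∈ Finset.Icc 1 N, ‖(Ψ : ℤ → ℂ) k‖ * ‖(Φ : ℤ → ℂ) k‖ := by
    refine (norm_sum_le _ _).trans (le_of_eq (Finset.sum_congr rfl fun k _ => ?_))
    simp
  have h2 := Finset.sum_mul_sq_le_sq_mul_sq (Finset.Icc 1 N)
    (fun k : ℕ => ‖(Ψ : ℤ → ℂ) k‖) (fun k : ℕ => ‖(Φ : ℤ → ℂ) k‖)
  rw [hre, hre, stateInner, norm_mul, mul_pow]
  calc _ ≤ ‖(1 / N : ℂ)‖ ^ 2 *
      (∑ k ∈ Finset.Icc 1 N, ‖(Ψ : ℤ → ℂ) k‖ * ‖(Φ : ℤ → ℂ) k‖) ^ 2 := by gcongr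
    _ ≤ ‖(1 / N : ℂ)‖ ^ 2 * ((∑ k ∈ Finset.Icc 1 N, ‖(Ψ : ℤ → ℂ) k‖ ^ 2) *
      (∑ k ∈ Finset.Icc 1 N, ‖(Φ : ℤ → ℂ) k‖ ^ 2)) := by gcongr
    _ = _ := by
      rw [norm_div, norm_one, Complex.norm_natCast]
      ring

theorem sum_Icc_add_one {F : ℤ → ℂ} (hF : ∀ k, F (k + N) = F k) :
    ∑ k ∈ Finset.Icc 1 N, F ((k : ℤ) + 1) = ∑ k ∈ Finset.Icc 1 N, F k := by
  rcases Nat.eq_zero_or_pos N with hN | hN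
  · subst hN
    simp
  have h1 : ∀ G : ℕ → ℂ, ∑ k ∈ Finset.Icc 1 N, G k = ∑ k ∈ Finset.range N, G (k + 1) := by
    intro G
    rw [Finset.range_eq_Ico, Finset.sum_Ico_add' G 0 N 1]
    rfl
  rw [h1 (fun k => F ((k : ℤ) + 1)), h1 (fun k => F k)]
  have h2 := Finset.sum_range_succ (fun k : ℕ => F ((k : ℤ) + 1)) N
  have h3 := Finset.sum_range_succ' (fun k : ℕ => F ((k : ℤ) + 1)) N
  have h4 : F ((N : ℤ) + 1) = F ((0 : ℕ) + 1) := by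
    rw [add_comm, hF]
    simp
  rw [h3, h4] at h2
  simpa using h2

theorem sum_Icc_add {F : ℤ → ℂ} (hF : ∀ k, F (k + N) = F k) (a : ℤ) :
    ∑ k ∈ Finset.Icc 1 N, F ((k : ℤ) + a) = ∑ k ∈ Finset.Icc 1 N, F k := by
  have key : ∀ b : ℤ, ∑ k ∈ Finset.Icc 1 N, F ((k : ℤ) + (b + 1)) =
      ∑ k ∈ Finset.Icc 1 N, F ((k : ℤ) + b) := by
    intro b
    have := sum_Icc_add_one (N := N) (F := fun k => F (k + b))
      (fun k => by rw [show k + (N : ℤ) + b = k + b + N by ring, hF])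
    rw [← this]
    refine Finset.sum_congr rfl fun k _ => ?_
    congr 1
    ring
  induction a using Int.induction_on with
  | zero => simp
  | succ i ih => rw [key, ih]
  | pred i ih =>
    rw [← ih, ← key, sub_add_cancel]

/-- The quasi-periodicity factors of the two states cancel in the summand, so the sum over a period
may be shifted by n₁; the phase is then conjugated. -/
theorem stateInner_translationN (n : ℤ × ℤ) (Ψ Φ : State N κ) :
    stateInner (translationN N κ n Ψ) Φ = stateInner Ψ (translationN N κ (-n) Φ) := by
  have h1 : ‖Complex.exp (-2 * Real.pi * Complex.I * κ.2)‖ = 1 := by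
    simp [Complex.norm_exp]
  have hN0 : ∀ Ψ Φ : State N κ, ∀ k : ℤ, (Ψ : ℤ → ℂ) (k + N) *
      (starRingEnd ℂ) ((Φ : ℤ → ℂ) (k + N)) = (Ψ : ℤ → ℂ) k * (starRingEnd ℂ) ((Φ : ℤ → ℂ) k) := by
    intro Ψ Φ k
    rw [Ψ.2 k, Φ.2 k, map_mul, mul_mul_mul_comm, Complex.mul_conj, Complex.normSq_eq_norm_sq, h1]
    simp
  rw [stateInner, stateInner]
  congr 1
  refine (sum_Icc_add (F := fun k => (translationN N κ n Ψ : ℤ → ℂ) k *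
    (starRingEnd ℂ) ((Φ : ℤ → ℂ) k)) (hN0 (translationN N κ n Ψ) Φ) n.1).symm.trans ?_
  refine Finset.sum_congr rfl fun k _ => ?_
  rw [translationN_apply, translationN_apply, add_sub_cancel_right]
  simp only [Prod.fst_neg, sub_neg_eq_add, map_mul, ← Complex.exp_conj, Prod.snd_neg]
  rw [mul_comm (Complex.exp _), mul_assoc]
  congr 3
  simp [map_ofNat]
  ring

/-- Conjugation by the translation m preserves the trace but multiplies the operator by exp(2πi(m₂n₁
− m₁n₂)/N). A non-zero trace makes this factor 1 for every m; the two unit vectors m give the two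
divisibilities. -/
theorem trace_translationN (hN : 0 < N) {n : ℤ × ℤ}
    (hn : ¬ ((N : ℤ) ∣ n.1 ∧ (N : ℤ) ∣ n.2)) :
    LinearMap.trace ℂ (State N κ) (translationN N κ n) = 0 := by
  have hN' : (N : ℂ) ≠ 0 := by exact_mod_cast hN.ne'
  have hconj : ∀ m : ℤ × ℤ, LinearMap.trace ℂ (State N κ) (translationN N κ n) ≠ 0 →
      weylPhase N m n * weylPhase N (m + n) (-m) = 1 := by
    intro m h
    have h1 := LinearMap.trace_mul_comm ℂ (translationN N κ m * translationN N κ n)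
      (translationN N κ (-m))
    have h2 : translationN N κ (-m) * translationN N κ m = 1 := by
      simpa using translationN_mul_neg (κ := κ) (N := N) (-m)
    rw [translationN_mul_mul_neg, ← mul_assoc, h2, one_mul, map_smul, smul_eq_mul] at h1
    exact mul_right_cancel₀ h (h1.trans (one_mul _).symm)
  have hphase : ∀ m : ℤ × ℤ, weylPhase N m n * weylPhase N (m + n) (-m) =
      Complex.exp (2 * Real.pi * Complex.I * (((m.2 * n.1 - m.1 * n.2 : ℤ) : ℂ) / N)) := by
    intro m
    rw [weylPhase, weylPhase, ← Complex.exp_add]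
    congr 1
    simp
    field_simp
    ring
  have hdvd : ∀ a : ℤ, Complex.exp (2 * Real.pi * Complex.I * ((a : ℂ) / N)) = 1 →
      (N : ℤ) ∣ a := by
    intro a ha
    obtain ⟨b, hb⟩ := Complex.exp_eq_one_iff.1 ha
    refine ⟨b, ?_⟩
    have h1 : (2 * Real.pi * Complex.I : ℂ) ≠ 0 := Complex.two_pi_I_ne_zero
    rw [mul_comm (b : ℂ)] at hb
    have h2 := mul_left_cancel₀ h1 hb
    rw [div_eq_iff hN'] at h2
    have : (a : ℂ) = (N : ℂ) * b := by rw [h2]; ring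
    exact_mod_cast this
  by_contra h
  refine hn ⟨?_, ?_⟩
  · have := hconj (0, 1) h
    rw [hphase] at this
    simpa using hdvd _ this
  · have := hconj (1, 0) h
    rw [hphase] at this
    simpa using hdvd _ this

end Algebra

/-! ### The Egorov identity and the embedding of states into distributions. -/

/-- After the substitution q' ↦ q' − v₁ in the second integral the two integrands agree pointwise:
both phases are the same quadratic polynomial once C is eliminated by the determinant condition. -/
theorem metaplectic_translation {h A B C D : ℝ} (hh : h ≠ 0) (hB : B ≠ 0) (hdet : A * D - B * C = 1)
    (v : ℝ × ℝ) (f : 𝓢(ℝ, ℂ)) :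
    metaplectic h A B D (translation h v f) =
      translation h (A * v.1 + B * v.2, C * v.1 + D * v.2) (metaplectic h A B D f) := by
  ext q
  rw [metaplectic_apply hh hB, translation_apply, metaplectic_apply hh hB, ← integral_const_mul]
  refine Eq.trans ?_ (integral_sub_right_eq_self _ v.1)
  refine integral_congr_ae (Eventually.of_forall fun q' => ?_)
  simp only [translation_apply, kernel]
  have e : Complex.exp (Complex.I *
        ((Real.pi / (h * B) * (D * q ^ 2 - 2 * q * q' + A * q' ^ 2) : ℝ) : ℂ)) *
      Complex.exp (Complex.I * ((2 * Real.pi / h * v.2 * (q' - v.1 / 2) : ℝ) : ℂ)) =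
      Complex.exp (Complex.I * ((2 * Real.pi / h * (C * v.1 + D * v.2) *
        (q - (A * v.1 + B * v.2) / 2) : ℝ) : ℂ)) *
      Complex.exp (Complex.I * ((Real.pi / (h * B) * (D * (q - (A * v.1 + B * v.2)) ^ 2 -
        2 * (q - (A * v.1 + B * v.2)) * (q' - v.1) + A * (q' - v.1) ^ 2) : ℝ) : ℂ)) := by
    rw [← Complex.exp_add, ← Complex.exp_add, ← mul_add, ← mul_add, ← Complex.ofReal_add,
      ← Complex.ofReal_add]
    congr 3
    have hC : C = (A * D - 1) / B := by
      field_simp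
      linarith
    rw [hC]
    field_simp
    ring
  linear_combination ((1 / (Complex.I * h * B)) ^ (1 / 2 : ℂ)) * f (q' - v.1) * e

/-- The action of `M ∈ SL(2, ℤ)` on `ℤ²`. -/
def latticeMap (M : SL(2, ℤ)) (n : ℤ × ℤ) : ℤ × ℤ :=
  (M 0 0 * n.1 + M 0 1 * n.2, M 1 0 * n.1 + M 1 1 * n.2)

theorem det_entries (M : SL(2, ℤ)) : M 0 0 * M 1 1 - M 0 1 * M 1 0 = 1 := by
  have := M.2
  rwa [Matrix.det_fin_two] at this

/-- The exact Egorov property. -/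
theorem quantization_translationDist {M : SL(2, ℤ)} (hB : M 0 1 ≠ 0) {h : ℝ} (hh : h ≠ 0)
    (v : ℝ × ℝ) (u : 𝓢'(ℝ, ℂ)) :
    quantization h M (translationDist h v u) =
      translationDist h (M 0 0 * v.1 + M 0 1 * v.2, M 1 0 * v.1 + M 1 1 * v.2)
        (quantization h M u) := by
  ext f
  change u (translation h (-v.1, v.2) (metaplectic h (M 1 1) (M 0 1) (M 0 0) f)) =
    u (metaplectic h (M 1 1) (M 0 1) (M 0 0) (translation h
      (-(M 0 0 * v.1 + M 0 1 * v.2), M 1 0 * v.1 + M 1 1 * v.2) f))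
  have hd : (M 0 0 : ℝ) * M 1 1 - M 0 1 * M 1 0 = 1 := by exact_mod_cast det_entries M
  -- On test functions the relevant matrix is M with its diagonal entries exchanged. This is M⁻¹
  -- conjugated by the reflection of the first coordinate, so it undoes M on the reflected vector.
  rw [metaplectic_translation (C := M 1 0) hh (by exact_mod_cast hB) (by linarith)]
  congr 3
  ext
  · linear_combination v.1 * hd
  · linear_combination (-v.2) * hd

theorem toDist_sum {N : ℕ} {κ : ℝ × ℝ} (hN : 0 < N) {ι : Type*} (s : Finset ι) (c : ι → ℂ)
    (f : ι → State N κ) : toDist (∑ i ∈ s, c i • f i) = ∑ i ∈ s, c i • toDist (f i) := by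
  classical
  have hadd : ∀ Ψ Φ : State N κ, toDist (Ψ + Φ) = toDist Ψ + toDist Φ := by
    intro Ψ Φ
    ext g
    change _ = toDist Ψ g + toDist Φ g
    rw [toDist_apply hN, toDist_apply hN, toDist_apply hN,
      ← (summable_state hN Ψ g).tsum_add (summable_state hN Φ g)]
    simp [add_mul]
  have hsmul : ∀ (c : ℂ) (Ψ : State N κ), toDist (c • Ψ) = c • toDist Ψ := by
    intro c Ψ
    ext g
    change _ = c * toDist Ψ g
    rw [toDist_apply hN, toDist_apply hN, ← tsum_mul_left]
    simp [mul_assoc]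
  induction s using Finset.induction_on with
  | empty =>
    ext g
    rw [Finset.sum_empty, Finset.sum_empty, toDist_apply hN]
    exact (tsum_congr fun k => zero_mul _).trans tsum_zero
  | insert a s ha ih => rw [Finset.sum_insert ha, Finset.sum_insert ha, hadd, hsmul, ih]

/-- The point masses are 1/N apart, so a bump of outer radius 1/(2N) around one of them reads off
its coefficient. -/
theorem toDist_injective {N : ℕ} {κ : ℝ × ℝ} (hN : 0 < N) :
    Function.Injective (toDist : State N κ → 𝓢'(ℝ, ℂ)) := by
  intro Ψ Φ h
  ext k
  have hN' : (0 : ℝ) < N := by exact_mod_cast hN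
  let b : ContDiffBump (((k : ℝ) + κ.1) / N) := ⟨1 / (4 * N), 1 / (2 * N), by positivity, by
    gcongr; norm_num⟩
  have hb1 : HasCompactSupport (fun x => (b x : ℂ)) := by
    refine b.hasCompactSupport.comp_left (g := fun x : ℝ => (x : ℂ)) rfl
  let g : 𝓢(ℝ, ℂ) := hb1.toSchwartzMap (Complex.ofRealCLM.contDiff.comp b.contDiff)
  have hg : ∀ x, g x = (b x : ℂ) := fun x => rfl
  have hval : ∀ Ψ : State N κ, toDist Ψ g = (Ψ : ℤ → ℂ) k := by
    intro Ψ
    rw [toDist_apply hN, tsum_eq_single k]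
    · rw [hg, b.one_of_mem_closedBall (by simp [b])]
      simp
    · intro l hl
      rw [hg, b.zero_of_le_dist, Complex.ofReal_zero, mul_zero]
      have h1 : (1 : ℝ) ≤ |((l : ℝ) - k)| := by
        have : 1 ≤ |l - k| := Int.one_le_abs (sub_ne_zero.2 hl)
        exact_mod_cast this
      change 1 / (2 * (N : ℝ)) ≤ _
      rw [Real.dist_eq, ← sub_div, add_sub_add_right_eq_sub, abs_div, abs_of_pos hN',
        div_le_div_iff₀ (by positivity) hN']
      nlinarith
  rw [← hval, ← hval, h]

/-! ### Mean squares of matrix elements over an eigenbasis. -/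

section Eigenbasis

variable {M : SL(2, ℤ)} {N : ℕ} {κ : ℝ × ℝ} {φ : Fin N → State N κ}

theorem IsEigenbasis.stateInner_sum_smul (hφ : IsEigenbasis M φ) (c : Fin N → ℂ) (j : Fin N) :
    stateInner (∑ i, c i • φ i) (φ j) = c j := by
  rw [stateInner_sum_left]
  simp [hφ.orthonormal]

theorem IsEigenbasis.linearIndependent (hφ : IsEigenbasis M φ) : LinearIndependent ℂ φ := by
  rw [Fintype.linearIndependent_iff]
  intro c hc j
  rw [← hφ.stateInner_sum_smul c j, hc]
  simp [stateInner]

/-- An eigenbasis is a basis. -/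
def IsEigenbasis.basis (hφ : IsEigenbasis M φ) (hN : 0 < N) :
    Module.Basis (Fin N) ℂ (State N κ) :=
  haveI : Nonempty (Fin N) := ⟨⟨0, hN⟩⟩
  basisOfLinearIndependentOfCardEqFinrank hφ.linearIndependent (by
    have := finiteDimensional_state (κ := κ) hN
    refine le_antisymm hφ.linearIndependent.fintype_card_le_finrank ?_
    simpa using finrank_state_le hN)

theorem IsEigenbasis.coe_basis (hφ : IsEigenbasis M φ) (hN : 0 < N) : ⇑(hφ.basis hN) = φ := by
  simp [IsEigenbasis.basis]

theorem IsEigenbasis.repr (hφ : IsEigenbasis M φ) (hN : 0 < N) (Ψ : State N κ) (j : Fin N) :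
    (hφ.basis hN).repr Ψ j = stateInner Ψ (φ j) := by
  conv_rhs => rw [← (hφ.basis hN).sum_repr Ψ, hφ.coe_basis hN]
  rw [hφ.stateInner_sum_smul]

theorem IsEigenbasis.sum_stateInner_smul (hφ : IsEigenbasis M φ) (hN : 0 < N) (Ψ : State N κ) :
    ∑ j, stateInner Ψ (φ j) • φ j = Ψ := by
  conv_rhs => rw [← (hφ.basis hN).sum_repr Ψ]
  simp only [hφ.repr hN, hφ.coe_basis hN]

theorem IsEigenbasis.trace_eq (hφ : IsEigenbasis M φ) (hN : 0 < N)
    (T : State N κ →ₗ[ℂ] State N κ) :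
    LinearMap.trace ℂ _ T = ∑ j, stateInner (T (φ j)) (φ j) := by
  rw [LinearMap.trace_eq_matrix_trace ℂ (hφ.basis hN), Matrix.trace]
  refine Finset.sum_congr rfl fun j _ => ?_
  rw [Matrix.diag_apply, LinearMap.toMatrix_apply, hφ.repr, hφ.coe_basis]

/-- Matrix elements in an eigenbasis are invariant under the classical dynamics. -/
theorem IsEigenbasis.stateInner_latticeMap (hφ : IsEigenbasis M φ) (hN : 0 < N)
    (hB : M 0 1 ≠ 0) (n : ℤ × ℤ) (j : Fin N) :
    stateInner (translationN N κ (latticeMap M n) (φ j)) (φ j) =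
      stateInner (translationN N κ n (φ j)) (φ j) := by
  choose θ hθ using hφ.eigen
  set lam : Fin N → ℂ := fun i => Complex.exp (Complex.I * θ i) with hlam
  have hlam0 : lam j ≠ 0 := Complex.exp_ne_zero _
  have hh : (1 / (N : ℝ)) ≠ 0 := by positivity
  -- The Egorov identity is applied to φ_j with the translated state expanded in the eigenbasis. The
  -- coefficient of φ_j carries the factor λ_j on both sides, so it cancels, and no adjoint of M̂ is
  -- needed.
  have hcomm : toDist (lam j • translationN N κ (latticeMap M n) (φ j)) =
      toDist (∑ i, (lam i * stateInner (translationN N κ n (φ j)) (φ i)) • φ i) := by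
    have h1 := quantization_translationDist hB hh ((n.1 : ℝ) / N, (n.2 : ℝ) / N) (toDist (φ j))
    rw [← toDist_translationN hN, hθ j, map_smul] at h1
    have h2 : ((M 0 0 : ℝ) * ((n.1 : ℝ) / N) + M 0 1 * ((n.2 : ℝ) / N),
        (M 1 0 : ℝ) * ((n.1 : ℝ) / N) + M 1 1 * ((n.2 : ℝ) / N)) =
        (((latticeMap M n).1 : ℝ) / N, ((latticeMap M n).2 : ℝ) / N) := by
      simp only [latticeMap]
      push_cast
      ext <;> ring
    simp only at h1
    rw [h2, ← toDist_translationN hN, ← hφ.sum_stateInner_smul hN (translationN N κ n (φ j)),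
      toDist_sum hN, map_sum] at h1
    have h3 := toDist_sum hN {()} (fun _ => lam j)
      (fun _ => translationN N κ (latticeMap M n) (φ j))
    simp only [Finset.sum_singleton] at h3
    rw [h3, ← h1, toDist_sum hN]
    refine Finset.sum_congr rfl fun i _ => ?_
    rw [map_smul, hθ i, smul_smul, mul_comm]
  have h4 := congrArg (fun Ψ => stateInner Ψ (φ j)) (toDist_injective hN hcomm)
  simp only [stateInner_smul_left, hφ.stateInner_sum_smul] at h4
  exact mul_left_cancel₀ hlam0 h4

/-- The variance bound: if the first `T` points of the orbit of `n` are distinct modulo `N`, the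
matrix elements of `T̂_N(n)` in an eigenbasis have mean square at most `1 / T`. -/
theorem IsEigenbasis.sum_norm_sq_le (hφ : IsEigenbasis M φ) (hN : 0 < N)
    (hB : M 0 1 ≠ 0) (n : ℤ × ℤ) {T : ℕ} (hT : 0 < T)
    (hdist : ∀ s < T, ∀ t < T, s ≠ t →
      ¬ ((N : ℤ) ∣ ((latticeMap M)^[s] n - (latticeMap M)^[t] n).1 ∧
        (N : ℤ) ∣ ((latticeMap M)^[s] n - (latticeMap M)^[t] n).2)) :
    ∑ j, ‖stateInner (translationN N κ n (φ j)) (φ j)‖ ^ 2 ≤ (N : ℝ) / T := by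
  set p : ℕ → ℤ × ℤ := fun t => (latticeMap M)^[t] n with hp
  have hinv : ∀ (t : ℕ) j, stateInner (translationN N κ (p t) (φ j)) (φ j) =
      stateInner (translationN N κ n (φ j)) (φ j) := by
    intro t j
    induction t with
    | zero => rfl
    | succ t ih =>
      rw [← ih, ← hφ.stateInner_latticeMap hN hB (p t) j, hp]
      simp only [Function.iterate_succ', Function.comp_apply]
  -- The orbit sum applied to φ_j: by invariance its component along φ_j is T times the matrix
  -- element, so Cauchy–Schwarz bounds T² times the square by ‖A_j‖².
  set A : Fin N → State N κ := fun j => ∑ t ∈ Finset.range T, translationN N κ (p t) (φ j) with hA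
  have hAj : ∀ j, stateInner (A j) (φ j) = T * stateInner (translationN N κ n (φ j)) (φ j) := by
    intro j
    rw [hA, stateInner_sum]
    simp [hinv]
  -- Summed over j, the squared norms become a double sum of traces. Terms with s ≠ t vanish because
  -- the orbit points differ modulo N; each of the T diagonal terms is the trace N of the identity.
  have hAA : ∑ j, stateInner (A j) (A j) = (T : ℂ) * N := by
    have h1 : ∀ j, stateInner (A j) (A j) = ∑ s ∈ Finset.range T, ∑ t ∈ Finset.range T,
        weylPhase N (-p s) (p t) * stateInner (translationN N κ (p t - p s) (φ j)) (φ j) := by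
      intro j
      rw [hA, stateInner_sum_right]
      refine Finset.sum_congr rfl fun s _ => ?_
      rw [stateInner_sum]
      refine Finset.sum_congr rfl fun t _ => ?_
      have h2 := stateInner_translationN (-p s) (translationN N κ (p t) (φ j)) (φ j)
      rw [neg_neg] at h2
      rw [← h2, ← Module.End.mul_apply, translationN_mul, LinearMap.smul_apply,
        stateInner_smul_left, neg_add_eq_sub]
    simp_rw [h1]
    rw [Finset.sum_comm]
    have h3 : ∀ s ∈ Finset.range T, ∑ j, ∑ t ∈ Finset.range T,
        weylPhase N (-p s) (p t) * stateInner (translationN N κ (p t - p s) (φ j)) (φ j) =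
          (N : ℂ) := by
      intro s hs
      rw [Finset.sum_comm, Finset.sum_eq_single s]
      · have : weylPhase N (-p s) (p s) = 1 := by
          rw [weylPhase]
          simp only [Prod.fst_neg, Prod.snd_neg, Int.cast_neg]
          rw [show (-((p s).2 : ℂ) * ((p s).1 : ℂ) - -((p s).1 : ℂ) * ((p s).2 : ℂ)) = 0 by ring]
          simp
        simp [this, translationN_zero, hφ.orthonormal]
      · intro t ht hts
        rw [← Finset.mul_sum, ← hφ.trace_eq hN, trace_translationN hN, mul_zero]
        exact hdist t (Finset.mem_range.1 ht) s (Finset.mem_range.1 hs) hts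
      · exact fun h => absurd hs h
    rw [Finset.sum_congr rfl h3]
    simp
  have hTR : (0 : ℝ) < T := by exact_mod_cast hT
  have h5 : ∀ j, (T : ℝ) ^ 2 * ‖stateInner (translationN N κ n (φ j)) (φ j)‖ ^ 2 ≤
      (stateInner (A j) (A j)).re := by
    intro j
    have h6 := norm_sq_stateInner_le (A j) (φ j)
    rw [hAj, hφ.orthonormal, if_pos rfl, Complex.one_re, mul_one, norm_mul,
      Complex.norm_natCast, mul_pow] at h6
    exact h6
  have h7 := Finset.sum_le_sum fun j (_ : j ∈ Finset.univ) => h5 j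
  rw [← Finset.mul_sum, ← Complex.re_sum, hAA] at h7
  have h8 : ((T : ℂ) * N).re = (T : ℝ) * N := by
    have : ((T : ℂ) * N) = ((T * N : ℝ) : ℂ) := by push_cast; rfl
    rw [this, Complex.ofReal_re]
  rw [h8] at h7
  rw [le_div_iff₀ hTR]
  nlinarith

end Eigenbasis

/-! ### Orbits of the hyperbolic lattice map and the logarithmic variance bound. -/

/-- A periodic sequence attains its maximum of |u|. The recurrence centred there gives |τ||u| ≤
2|u|, hence u = 0. -/
theorem eq_zero_of_recurrence_of_periodic {u : ℕ → ℤ} {τ : ℤ} (hτ : 2 < |τ|)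
    (hu : ∀ t, u (t + 2) = τ * u (t + 1) - u t) {k : ℕ} (hk : 0 < k)
    (hper : Function.Periodic u k) (t : ℕ) : u t = 0 := by
  obtain ⟨i, -, hi⟩ := (Finset.range k).exists_max_image (fun i => |u i|) ⟨0, by simpa using hk⟩
  have hle : ∀ t, |u t| ≤ |u i| := by
    intro t
    have := hi (t % k) (Finset.mem_range.2 (Nat.mod_lt _ hk))
    rwa [hper.map_mod_nat] at this
  -- The maximum is moved from i to i + k, so that it has a predecessor even when i = 0.
  have h1 := hu (i + k - 1)
  rw [show i + k - 1 + 1 = i + k by omega, hper] at h1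
  have h2 : |τ| * |u i| ≤ |u i| + |u i| := by
    rw [← abs_mul, show τ * u i = u (i + k - 1 + 2) + u (i + k - 1) by linarith]
    exact (abs_add_le _ _).trans (add_le_add (hle _) (hle _))
  have h3 : |u i| = 0 := by
    by_contra h
    have h4 : 0 < |u i| := lt_of_le_of_ne (abs_nonneg _) (Ne.symm h)
    nlinarith
  exact abs_eq_zero.1 (le_antisymm (h3 ▸ hle t) (abs_nonneg _))

/-- Cayley–Hamilton for a matrix of determinant one. -/
theorem latticeMap_latticeMap (M : SL(2, ℤ)) (n : ℤ × ℤ) :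
    latticeMap M (latticeMap M n) = (M 0 0 + M 1 1) • latticeMap M n - n := by
  have h := det_entries M
  ext
  · simp only [latticeMap, Prod.fst_sub, Prod.smul_fst, smul_eq_mul]
    linear_combination (-n.1) * h
  · simp only [latticeMap, Prod.snd_sub, Prod.smul_snd, smul_eq_mul]
    linear_combination (-n.2) * h

theorem latticeMap_injective (M : SL(2, ℤ)) : Function.Injective (latticeMap M) := by
  intro m n hmn
  have h := det_entries M
  have h1 := congrArg Prod.fst hmn
  have h2 := congrArg Prod.snd hmn
  simp only [latticeMap] at h1 h2
  ext
  · linear_combination (-(m.1 - n.1)) * h + M 1 1 * h1 - M 0 1 * h2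
  · linear_combination (-(m.2 - n.2)) * h + M 0 0 * h2 - M 1 0 * h1

/-- A coincidence would make the orbit periodic from time s on. Each coordinate obeys the trace
recurrence, so the orbit would be zero there, and injectivity would give n = 0. -/
theorem iterate_latticeMap_ne {M : SL(2, ℤ)} (hM : 2 < |M 0 0 + M 1 1|) {n : ℤ × ℤ} (hn : n ≠ 0)
    {s t : ℕ} (hst : s < t) : (latticeMap M)^[s] n ≠ (latticeMap M)^[t] n := by
  intro h
  set u : ℕ → ℤ × ℤ := fun i => (latticeMap M)^[s + i] n with hu
  have hrec : ∀ i, u (i + 2) = (M 0 0 + M 1 1) • u (i + 1) - u i := by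
    intro i
    simp only [hu, ← add_assoc, Function.iterate_succ', Function.comp_apply]
    exact latticeMap_latticeMap M _
  have hper : Function.Periodic u (t - s) := by
    intro i
    simp only [hu]
    rw [show s + (i + (t - s)) = i + t by omega, Function.iterate_add_apply, ← h,
      ← Function.iterate_add_apply, add_comm]
  have h0 : u 0 = 0 := by
    ext
    · exact eq_zero_of_recurrence_of_periodic (u := fun i => (u i).1) hM
        (fun i => by simp [hrec i]) (Nat.sub_pos_of_lt hst) (fun i => by simp only [hper i]) 0
    · exact eq_zero_of_recurrence_of_periodic (u := fun i => (u i).2) hM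
        (fun i => by simp [hrec i]) (Nat.sub_pos_of_lt hst) (fun i => by simp only [hper i]) 0
  refine hn ((latticeMap_injective M).iterate s ?_)
  have h1 : (latticeMap M)^[s] 0 = 0 :=
    Function.iterate_fixed (by simp [latticeMap]) s
  rw [h1]
  exact h0

/-- A bound for the expansion rate of `latticeMap M`. -/
def expansion (M : SL(2, ℤ)) : ℤ := 2 + |M 0 0| + |M 0 1| + |M 1 0| + |M 1 1|

theorem two_le_expansion (M : SL(2, ℤ)) : 2 ≤ expansion M := by
  unfold expansion
  linarith [abs_nonneg (M 0 0), abs_nonneg (M 0 1), abs_nonneg (M 1 0), abs_nonneg (M 1 1)]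

/-- A crude growth rate is enough: it affects only the constant in front of log N in the admissible
time. -/
theorem abs_iterate_latticeMap_le (M : SL(2, ℤ)) {n : ℤ × ℤ} {d : ℤ} (h1 : |n.1| ≤ d)
    (h2 : |n.2| ≤ d) (t : ℕ) :
    |((latticeMap M)^[t] n).1| ≤ expansion M ^ t * d ∧
      |((latticeMap M)^[t] n).2| ≤ expansion M ^ t * d := by
  induction t with
  | zero => simpa using ⟨h1, h2⟩
  | succ t ih =>
    rw [Function.iterate_succ', Function.comp_apply]
    set p := (latticeMap M)^[t] n
    set e := expansion M ^ t * d with he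
    have he0 : 0 ≤ e := (abs_nonneg _).trans ih.1
    have key : ∀ a b : ℤ, |a| + |b| ≤ expansion M →
        |a * p.1 + b * p.2| ≤ expansion M ^ (t + 1) * d := by
      intro a b hab
      calc |a * p.1 + b * p.2| ≤ |a| * |p.1| + |b| * |p.2| := by
            simpa only [abs_mul] using abs_add_le (a * p.1) (b * p.2)
        _ ≤ |a| * e + |b| * e := by gcongr; exacts [ih.1, ih.2]
        _ = (|a| + |b|) * e := by ring
        _ ≤ expansion M * e := by gcongr
        _ = _ := by rw [he]; ring
    have := abs_nonneg (M 0 0)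
    have := abs_nonneg (M 0 1)
    have := abs_nonneg (M 1 0)
    have := abs_nonneg (M 1 1)
    exact ⟨key _ _ (by unfold expansion; linarith), key _ _ (by unfold expansion; linarith)⟩

/-- Before the orbit leaves the square of half side N/2, differences of its points have entries
smaller than N, so congruence modulo N is equality. -/
theorem iterate_latticeMap_not_dvd {M : SL(2, ℤ)} (hM : 2 < |M 0 0 + M 1 1|) {n : ℤ × ℤ}
    (hn : n ≠ 0) {d : ℤ} (h1 : |n.1| ≤ d) (h2 : |n.2| ≤ d) {N T : ℕ}
    (hT : ∀ t < T, 2 * (expansion M ^ t * d) < N) :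
    ∀ s < T, ∀ t < T, s ≠ t →
      ¬ ((N : ℤ) ∣ ((latticeMap M)^[s] n - (latticeMap M)^[t] n).1 ∧
        (N : ℤ) ∣ ((latticeMap M)^[s] n - (latticeMap M)^[t] n).2) := by
  intro s hs t ht hst ⟨hd1, hd2⟩
  have hs1 := abs_iterate_latticeMap_le M h1 h2 s
  have ht1 := abs_iterate_latticeMap_le M h1 h2 t
  have hs2 := hT s hs
  have ht2 := hT t ht
  have heq : (latticeMap M)^[s] n = (latticeMap M)^[t] n := by
    rw [← sub_eq_zero]
    ext
    · refine Int.eq_zero_of_abs_lt_dvd hd1 ?_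
      rw [Prod.fst_sub]
      refine (abs_sub _ _).trans_lt ?_
      linarith [hs1.1, ht1.1]
    · refine Int.eq_zero_of_abs_lt_dvd hd2 ?_
      rw [Prod.snd_sub]
      refine (abs_sub _ _).trans_lt ?_
      linarith [hs1.2, ht1.2]
  rcases lt_or_gt_of_ne hst with h | h
  · exact iterate_latticeMap_ne hM hn h heq
  · exact iterate_latticeMap_ne hM hn h heq.symm

/-- With zero upper right entry the diagonal entries are integers with product 1, and the trace is
±2. -/
theorem upperRight_ne_zero {M : SL(2, ℤ)} (hM : 2 < |M 0 0 + M 1 1|) : M 0 1 ≠ 0 := by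
  intro h
  have h1 := det_entries M
  rw [h, zero_mul, sub_zero] at h1
  rcases Int.eq_one_or_neg_one_of_mul_eq_one' h1 with ⟨h2, h3⟩ | ⟨h2, h3⟩ <;>
    rw [h2, h3] at hM <;> norm_num at hM

/-- The quantum variance of `T̂_N(n)`, `n ≠ 0`, is `O(1 / log N)`, uniformly in `|n| ≤ √N / 4`. -/
theorem exists_variance_bound {M : SL(2, ℤ)} (hM : 2 < |M 0 0 + M 1 1|) :
    ∃ C : ℝ, 0 < C ∧ ∃ N₀ : ℕ, ∀ N ≥ N₀, ∀ (κ : ℝ × ℝ) (φ : Fin N → State N κ),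
      IsEigenbasis M φ → ∀ n : ℤ × ℤ, n ≠ 0 → ∀ d : ℤ, |n.1| ≤ d → |n.2| ≤ d →
      4 * (d : ℝ) ≤ √N →
      ∑ j, ‖stateInner (translationN N κ n (φ j)) (φ j)‖ ^ 2 ≤ C * N / Real.log N := by
  set K : ℝ := (expansion M : ℝ) with hK
  have hK2 : (2 : ℝ) ≤ K := by rw [hK]; exact_mod_cast two_le_expansion M
  have hlK : 0 < Real.log K := Real.log_pos (by linarith)
  -- The time y below solves K^y = √N, and N ≥ K² makes y ≥ 1. Then T = ⌊y⌋ ≥ y/2, so N/T ≤ 2N/y = 4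
  -- log K · N / log N.
  refine ⟨4 * Real.log K, by positivity, ⌈K ^ 2⌉₊, ?_⟩
  intro N hN κ φ hφ n hn d h1 h2 hd
  have hKN : K ^ 2 ≤ N := (Nat.le_ceil _).trans (by exact_mod_cast hN)
  have hNR : (0 : ℝ) < N := lt_of_lt_of_le (by positivity) hKN
  have hN0 : 0 < N := by exact_mod_cast hNR
  have hlog : 2 * Real.log K ≤ Real.log N := by
    have := Real.log_le_log (by positivity) hKN
    rwa [Real.log_pow, Nat.cast_ofNat] at this
  set y := Real.log N / (2 * Real.log K) with hy
  have hy1 : 1 ≤ y := by rw [hy, one_le_div (by positivity)]; exact hlog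
  set T := ⌊y⌋₊ with hTdef
  have hT0 : 0 < T := Nat.floor_pos.2 hy1
  have hTR : (1 : ℝ) ≤ T := by exact_mod_cast hT0
  have hTy : y ≤ 2 * T := by
    have := Nat.lt_floor_add_one y
    linarith
  have hpow : ∀ t < T, 2 * (expansion M ^ t * d) < (N : ℤ) := by
    intro t ht
    have h3 : K ^ t ≤ √N := by
      have hty : (t : ℝ) ≤ y := (Nat.cast_le.2 ht.le).trans (Nat.floor_le (by linarith))
      rw [← Real.log_le_log_iff (by positivity) (by positivity), Real.log_pow,
        Real.log_sqrt hNR.le]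
      rw [hy, le_div_iff₀ (by positivity)] at hty
      linarith
    have h4 : 2 * (K ^ t * d) < N := by
      have h5 : (0 : ℝ) ≤ d := by exact_mod_cast (abs_nonneg _).trans h1
      have h6 := Real.mul_self_sqrt hNR.le
      have h7 : K ^ t * (4 * d) ≤ √N * √N := by gcongr
      linarith
    rw [hK] at h4
    exact_mod_cast h4
  refine (hφ.sum_norm_sq_le hN0 (upperRight_ne_zero hM) n hT0
    (iterate_latticeMap_not_dvd hM hn h1 h2 hpow)).trans ?_
  have hlogN : 0 < Real.log N := by linarith
  rw [div_le_div_iff₀ (by linarith) hlogN]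
  rw [hy, div_le_iff₀ (by positivity)] at hTy
  nlinarith

/-! ### From the variance bound to quantum ergodicity. -/

theorem norm_character (n : ℤ × ℤ) (x : Torus) : ‖character n x‖ = 1 := by
  simp [character, fourier_apply, Circle.norm_coe]

theorem character_zero (x : Torus) : character 0 x = 1 := by
  simp [character]

instance : IsProbabilityMeasure (volume : Measure UnitAddCircle) :=
  ⟨UnitAddCircle.measure_univ⟩

instance : IsProbabilityMeasure (volume : Measure Torus) :=
  inferInstanceAs (IsProbabilityMeasure ((volume : Measure UnitAddCircle).prod volume))

instance : (volume : Measure Torus).IsAddLeftInvariant :=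
  inferInstanceAs ((volume : Measure UnitAddCircle).prod volume).IsAddLeftInvariant

theorem volume_disc (x : Torus) (r : ℝ) :
    volume.real (disc x r) = volume.real (disc (0 : Torus) r) := by
  have h : disc x r = (fun y => y + -x) ⁻¹' disc 0 r := by
    ext y
    simp [disc, sub_eq_add_neg]
  rw [h, measureReal_def, measureReal_def, measure_preimage_add_right]

/-- The non-zero lattice points of the square of half side `m`. -/
def puncturedBox (m : ℤ) : Finset (ℤ × ℤ) :=
  (Finset.Icc (-m) m ×ˢ Finset.Icc (-m) m).erase 0

theorem mem_puncturedBox {m : ℤ} {n : ℤ × ℤ} :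
    n ∈ puncturedBox m ↔ n ≠ 0 ∧ |n.1| ≤ m ∧ |n.2| ≤ m := by
  simp [puncturedBox, abs_le]

theorem card_puncturedBox_le {m : ℤ} (hm : 0 ≤ m) :
    ((puncturedBox m).card : ℝ) ≤ (2 * m + 1) ^ 2 := by
  have h1 : (puncturedBox m).card ≤ (2 * m + 1).toNat * (2 * m + 1).toNat := by
    refine (Finset.card_erase_le).trans (le_of_eq ?_)
    rw [Finset.card_product, Int.card_Icc, show m + 1 - -m = 2 * m + 1 by ring]
  have h2 : (((2 * m + 1).toNat : ℕ) : ℝ) = 2 * m + 1 := by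
    have : (((2 * m + 1).toNat : ℕ) : ℤ) = 2 * m + 1 := Int.toNat_of_nonneg (by linarith)
    exact_mod_cast congrArg (Int.cast : ℤ → ℝ) this
  calc ((puncturedBox m).card : ℝ) ≤ (((2 * m + 1).toNat * (2 * m + 1).toNat : ℕ) : ℝ) := by
        exact_mod_cast h1
    _ = _ := by rw [Nat.cast_mul, h2, sq]

/-- Translation multiplies the coefficients by unimodular numbers and fixes the zeroth one. The
bound therefore does not involve x, which is the source of uniformity in x. -/
theorem norm_stateInner_weylOp_sub_le {N : ℕ} {κ : ℝ × ℝ} {a : TrigPoly} {m : ℤ} {c : ℝ}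
    (ha : ∀ n : ℤ × ℤ, a n ≠ 0 → |n.1| ≤ m ∧ |n.2| ≤ m) (hc : ∀ n, ‖a n‖ ≤ c)
    {Ψ : State N κ} (hΨ : stateInner Ψ Ψ = 1) (x : Torus) :
    ‖stateInner (weylOp N κ (a.translate x) Ψ) Ψ - a 0‖ ≤
      c * ∑ n ∈ puncturedBox m, ‖stateInner (translationN N κ n Ψ) Ψ‖ := by
  classical
  have h0 : (0 : ℤ × ℤ) ∉ puncturedBox m := by simp [mem_puncturedBox]
  have hsub : (a.translate x).support ⊆ insert 0 (puncturedBox m) := by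
    intro n hn
    have h1 : n ∈ a.support := Finsupp.support_onFinset_subset hn
    by_cases h : n = 0
    · simp [h]
    · exact Finset.mem_insert_of_mem (mem_puncturedBox.2 ⟨h, ha n (Finsupp.mem_support_iff.1 h1)⟩)
  have h2 : stateInner (weylOp N κ (a.translate x) Ψ) Ψ = a 0 +
      ∑ n ∈ puncturedBox m, character n (-x) * a n * stateInner (translationN N κ n Ψ) Ψ := by
    rw [weylOp, Finsupp.sum_of_support_subset _ hsub _ (by simp), LinearMap.sum_apply]
    simp only [LinearMap.smul_apply]
    rw [stateInner_sum_left, Finset.sum_insert h0]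
    congr 1
    simp [TrigPoly.translate, character_zero, translationN_zero, hΨ]
  rw [h2, add_sub_cancel_left, Finset.mul_sum]
  refine norm_sum_le_of_le _ fun n _ => ?_
  rw [norm_mul, norm_mul, norm_character, one_mul]
  exact mul_le_mul_of_nonneg_right (hc n) (norm_nonneg _)

/-- Chebyshev's inequality for the sum F of the absolute matrix elements over all non-zero modes in
the box. F depends on neither the observables nor x, so the exceptional set is common to all of
them. -/
theorem IsMajorantMinorant.quantumErgodicityAtScale {M : SL(2, ℤ)} (hM : 2 < |M 0 0 + M 1 1|)
    {r D : ℕ → ℝ} (hr : ∀ᶠ N in atTop, r N ≠ 0) (hDtop : Tendsto D atTop atTop)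
    (hD : (fun N : ℕ => D N ^ 4) =o[atTop] fun N : ℕ => Real.log N)
    {aPlus aMinus : ℕ → TrigPoly} (ha : IsMajorantMinorant r D aPlus aMinus) :
    QuantumErgodicityAtScale M r aPlus aMinus := by
  intro κ _ φ hφ
  obtain ⟨C, hC, N₀, hvar⟩ := exists_variance_bound hM
  obtain ⟨c, hc⟩ := ha.coeff
  set F : (N : ℕ) → Fin N → ℝ := fun N j => ∑ n ∈ puncturedBox ⌊D N⌋,
    ‖stateInner (translationN N (κ N) n (φ N j)) (φ N j)‖ with hF
  -- The box has at most (2D + 1)² ≤ 9D² points, and Cauchy–Schwarz costs the square of this number.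
  set e : ℕ → ℝ := fun N => 81 * C * (D N ^ 4 / Real.log N) with he
  have he0 : Tendsto e atTop (𝓝 0) := by
    have := hD.tendsto_div_nhds_zero.const_mul (81 * C)
    rwa [mul_zero] at this
  have hF0 : ∀ N j, 0 ≤ F N j := fun N j => Finset.sum_nonneg fun _ _ => norm_nonneg _
  have hD1 : ∀ᶠ N in atTop, 1 ≤ D N := hDtop.eventually_ge_atTop 1
  -- All modes in the box must lie in the range where the variance bound is valid.
  have hsqrt : ∀ᶠ N : ℕ in atTop, 4 * D N ≤ √N := by
    have h1 : (fun N : ℕ => Real.log N) =o[atTop] fun N : ℕ => √(N : ℝ) := by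
      have := (isLittleO_log_rpow_atTop (r := 1 / 2) (by norm_num)).comp_tendsto
        tendsto_natCast_atTop_atTop
      simpa only [Function.comp_def, Real.sqrt_eq_rpow] using this
    filter_upwards [(hD.trans h1).def (c := 1 / 4) (by norm_num), hD1] with N h2 h3
    rw [Real.norm_of_nonneg (by positivity), Real.norm_of_nonneg (by positivity)] at h2
    have h4 : D N ≤ D N ^ 4 := le_self_pow₀ h3 (by norm_num)
    linarith
  have hepos : ∀ᶠ N : ℕ in atTop, 0 < e N ∧ 0 < N := by
    filter_upwards [hD1, eventually_ge_atTop 2] with N h1 h2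
    have : 0 < Real.log N := Real.log_pos (by exact_mod_cast h2)
    exact ⟨by simp only [he]; positivity, by omega⟩
  have hsum : ∀ᶠ N : ℕ in atTop, ∑ j, F N j ^ 2 ≤ e N * N := by
    filter_upwards [hD1, hsqrt, hepos, eventually_ge_atTop N₀] with N h1 h2 h3 h4
    have hfl : (⌊D N⌋ : ℝ) ≤ D N := Int.floor_le _
    have hfl0 : 0 ≤ ⌊D N⌋ := Int.floor_nonneg.2 (by linarith)
    have hfl0' : (0 : ℝ) ≤ ⌊D N⌋ := by exact_mod_cast hfl0
    have hcard : ((puncturedBox ⌊D N⌋).card : ℝ) ≤ 9 * D N ^ 2 :=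
      (card_puncturedBox_le hfl0).trans (by nlinarith)
    have hL : 0 ≤ C * N / Real.log N := by
      have := Real.log_natCast_nonneg N
      positivity
    calc ∑ j, F N j ^ 2 ≤ ∑ j, ((puncturedBox ⌊D N⌋).card : ℝ) * ∑ n ∈ puncturedBox ⌊D N⌋,
          ‖stateInner (translationN N (κ N) n (φ N j)) (φ N j)‖ ^ 2 :=
          Finset.sum_le_sum fun j _ => sq_sum_le_card_mul_sum_sq
      _ = ((puncturedBox ⌊D N⌋).card : ℝ) * ∑ n ∈ puncturedBox ⌊D N⌋, ∑ j,
          ‖stateInner (translationN N (κ N) n (φ N j)) (φ N j)‖ ^ 2 := by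
          rw [← Finset.mul_sum, Finset.sum_comm]
      _ ≤ ((puncturedBox ⌊D N⌋).card : ℝ) * ∑ n ∈ puncturedBox ⌊D N⌋, C * N / Real.log N := by
          gcongr with n hn
          obtain ⟨hn0, hn1, hn2⟩ := mem_puncturedBox.1 hn
          exact hvar N h4 (κ N) (φ N) (hφ N h3.2) n hn0 ⌊D N⌋ hn1 hn2 (by linarith)
      _ = ((puncturedBox ⌊D N⌋).card : ℝ) ^ 2 * (C * N / Real.log N) := by
          rw [Finset.sum_const, nsmul_eq_mul]
          ring
      _ ≤ (9 * D N ^ 2) ^ 2 * (C * N / Real.log N) := by gcongr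
      _ = e N * N := by
          simp only [he]
          ring
  -- The threshold √e balances both demands: at most √e · N indices are lost, and F ≤ e^(1/4) → 0 on
  -- the rest.
  set S : (N : ℕ) → Finset (Fin N) := fun N => Finset.univ.filter fun j => F N j ^ 2 ≤ √(e N)
    with hS
  refine ⟨S, ?_, ?_⟩
  · have hlow : Tendsto (fun N => 1 - √(e N)) atTop (𝓝 1) := by
      have := (Real.continuous_sqrt.tendsto 0).comp he0
      rw [Real.sqrt_zero] at this
      simpa [Function.comp_def] using this.const_sub 1
    refine tendsto_of_tendsto_of_tendsto_of_le_of_le' hlow tendsto_const_nhds ?_ ?_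
    · filter_upwards [hsum, hepos] with N h1 h2
      have hN : (0 : ℝ) < N := by exact_mod_cast h2.2
      have hs := Real.sqrt_pos.2 h2.1
      have hss := Real.mul_self_sqrt h2.1.le
      set Sc := Finset.univ.filter fun j => ¬ F N j ^ 2 ≤ √(e N) with hSc
      have hcard : ((S N).card : ℝ) + Sc.card = N := by
        have := Finset.card_filter_add_card_filter_not (s := (Finset.univ : Finset (Fin N)))
          (fun j => F N j ^ 2 ≤ √(e N))
        rw [Finset.card_univ, Fintype.card_fin] at this
        exact_mod_cast this
      have h3 : (Sc.card : ℝ) * √(e N) ≤ ∑ j, F N j ^ 2 := by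
        calc (Sc.card : ℝ) * √(e N) = ∑ j ∈ Sc, √(e N) := by simp
          _ ≤ ∑ j ∈ Sc, F N j ^ 2 :=
            Finset.sum_le_sum fun j hj => (not_le.1 (Finset.mem_filter.1 hj).2).le
          _ ≤ ∑ j, F N j ^ 2 := Finset.sum_le_sum_of_subset_of_nonneg (Finset.subset_univ _)
            fun _ _ _ => sq_nonneg _
      have h4 : (Sc.card : ℝ) ≤ √(e N) * N := by
        refine le_of_mul_le_mul_right ?_ hs
        calc _ ≤ _ := h3
          _ ≤ _ := h1
          _ = √(e N) * √(e N) * N := by rw [hss]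
          _ = _ := by ring
      rw [le_div_iff₀ hN]
      linarith
    · refine Eventually.of_forall fun N => ?_
      refine div_le_one_of_le₀ ?_ (Nat.cast_nonneg _)
      have := Finset.card_le_univ (S N)
      rw [Fintype.card_fin] at this
      exact_mod_cast this
  · intro ε hε
    have hsmall : ∀ᶠ N in atTop, |c| * √(√(e N)) ≤ ε / 2 := by
      have h1 := ((Real.continuous_sqrt.comp Real.continuous_sqrt).tendsto 0).comp he0
      have h2 := h1.const_mul |c|
      simp only [Function.comp_def, Real.sqrt_zero, mul_zero] at h2
      exact h2.eventually_le_const (by positivity)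
    filter_upwards [hsmall, hc, ha.degree, hr, ha.integral_plus.def (half_pos hε),
      ha.integral_minus.def (half_pos hε), hepos] with N h1 h2 h3 h4 h5 h6 h7
    intro j hj x
    have hFj : F N j ≤ √(√(e N)) := Real.le_sqrt_of_sq_le (Finset.mem_filter.1 hj).2
    have hdeg : ∀ n : ℤ × ℤ, ¬ (|n.1| ≤ ⌊D N⌋ ∧ |n.2| ≤ ⌊D N⌋) →
        D N ≤ √((n.1 : ℝ) ^ 2 + (n.2 : ℝ) ^ 2) := by
      intro n hn
      by_contra! hlt
      refine hn ⟨Int.le_floor.2 ?_, Int.le_floor.2 ?_⟩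
      · push_cast
        refine le_trans ?_ hlt.le
        exact Real.abs_le_sqrt (by nlinarith [sq_nonneg (n.2 : ℝ)])
      · push_cast
        refine le_trans ?_ hlt.le
        exact Real.abs_le_sqrt (by nlinarith [sq_nonneg (n.1 : ℝ)])
    have hself : stateInner (φ N j) (φ N j) = 1 := by
      rw [(hφ N h7.2).orthonormal, if_pos rfl]
    have key : ∀ a : TrigPoly, (∀ n, ‖a n‖ ≤ c * r N ^ 2) →
        (∀ n : ℤ × ℤ, D N ≤ √((n.1 : ℝ) ^ 2 + (n.2 : ℝ) ^ 2) → a n = 0) →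
        ‖a 0 - (volume.real (disc 0 (r N)) : ℂ)‖ ≤ ε / 2 * ‖r N ^ 2‖ →
        ‖stateInner (weylOp N (κ N) (a.translate x) (φ N j)) (φ N j) -
          (volume.real (disc x (r N)) : ℂ)‖ ≤ ε * r N ^ 2 := by
      intro a ha1 ha2 ha3
      have h8 := norm_stateInner_weylOp_sub_le (N := N) (κ := κ N) (a := a) (m := ⌊D N⌋)
        (c := |c| * r N ^ 2)
        (fun n hn => by by_contra h; exact hn (ha2 n (hdeg n h)))
        (fun n => (ha1 n).trans (by gcongr; exact le_abs_self c)) hself x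
      rw [Real.norm_of_nonneg (sq_nonneg _)] at ha3
      rw [volume_disc]
      refine (norm_sub_le_norm_sub_add_norm_sub _ (a 0) _).trans ?_
      have h9 : |c| * r N ^ 2 * F N j ≤ ε / 2 * r N ^ 2 := by
        calc |c| * r N ^ 2 * F N j ≤ |c| * r N ^ 2 * √(√(e N)) := by gcongr
          _ = |c| * √(√(e N)) * r N ^ 2 := by ring
          _ ≤ _ := by gcongr
      linarith
    exact ⟨key _ (fun n => (h2 n).1) (fun n hn => (h3 n hn).1) h5,
      key _ (fun n => (h2 n).2) (fun n hn => (h3 n hn).2) h6⟩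

/-! ### Fourier coefficients and distance on the torus. -/

instance : (volume : Measure Torus).IsNegInvariant :=
  ⟨((Measure.measurePreserving_neg (volume : Measure UnitAddCircle)).prod
    (Measure.measurePreserving_neg (volume : Measure UnitAddCircle))).map_eq⟩

theorem integral_fourier (n : ℤ) :
    ∫ t : UnitAddCircle, (fourier n t : ℂ) = if n = 0 then 1 else 0 := by
  have h := congrFun (fourierCoeff_fourier (T := 1) n) 0
  rw [fourierCoeff, AddCircle.integral_haarAddCircle] at h
  simp only [neg_zero, fourier_zero, one_smul, inv_one] at h
  rw [h, Pi.single_apply]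
  simp [eq_comm]

theorem integrable_of_continuous {f : UnitAddCircle → ℂ} (hf : Continuous f) : Integrable f :=
  hf.integrable_of_hasCompactSupport (HasCompactSupport.of_compactSpace f)

theorem integrable_of_continuous_real {f : UnitAddCircle → ℝ} (hf : Continuous f) :
    Integrable f :=
  hf.integrable_of_hasCompactSupport (HasCompactSupport.of_compactSpace f)

theorem integrable_torus {f : Torus → ℝ} (hf : Continuous f) : Integrable f :=
  hf.integrable_of_hasCompactSupport (HasCompactSupport.of_compactSpace f)

theorem continuous_character (n : ℤ × ℤ) : Continuous (character n) := by
  unfold character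
  fun_prop

theorem integral_character (n : ℤ × ℤ) : ∫ x, character n x = if n = 0 then 1 else 0 := by
  unfold character
  rw [Measure.volume_eq_prod, integral_prod_mul (fun t : UnitAddCircle => (fourier n.2 t : ℂ))
    (fun t : UnitAddCircle => (fourier (-n.1) t : ℂ)), integral_fourier, integral_fourier]
  rcases n with ⟨a, b⟩
  by_cases ha : a = 0 <;> by_cases hb : b = 0 <;> simp [ha, hb]

theorem character_add (m n : ℤ × ℤ) (x : Torus) :
    character (m + n) x = character m x * character n x := by
  simp only [character, Prod.fst_add, Prod.snd_add, neg_add, fourier_add]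
  ring

theorem TrigPoly.apply_eq_integral (a : TrigPoly) (n : ℤ × ℤ) :
    a n = ∫ x, a.eval x * character (-n) x := by
  have h1 : ∀ x, a.eval x * character (-n) x =
      ∑ m ∈ a.support, a m * character (m - n) x := by
    intro x
    rw [TrigPoly.eval, Finsupp.sum, Finset.sum_mul]
    refine Finset.sum_congr rfl fun m _ => ?_
    rw [sub_eq_add_neg, character_add]
    ring
  simp_rw [h1]
  have hint : ∀ m : ℤ × ℤ, Integrable fun x => a m * character (m - n) x := fun m =>
    (continuous_const.mul (continuous_character _)).integrable_of_hasCompactSupport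
      (HasCompactSupport.of_compactSpace _)
  rw [integral_finsetSum _ fun m _ => hint m]
  simp_rw [integral_const_mul, integral_character, sub_eq_zero]
  simp

/-- The distance of a point of the torus to `0`. -/
def torusNorm (x : Torus) : ℝ := √(‖x.1‖ ^ 2 + ‖x.2‖ ^ 2)

theorem torusNorm_nonneg (x : Torus) : 0 ≤ torusNorm x := Real.sqrt_nonneg _

/-- The identification with the L² product norm supplies the triangle inequality. -/
theorem torusNorm_eq_norm (x : Torus) : torusNorm x = ‖WithLp.toLp 2 x‖ := by
  rw [WithLp.prod_norm_eq_of_L2]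
  rfl

theorem torusNorm_add_le (x y : Torus) : torusNorm (x + y) ≤ torusNorm x + torusNorm y := by
  rw [torusNorm_eq_norm, torusNorm_eq_norm, torusNorm_eq_norm, WithLp.toLp_add]
  exact norm_add_le _ _

theorem continuous_torusNorm : Continuous torusNorm := by
  unfold torusNorm
  fun_prop

theorem torusNorm_sq (x : Torus) : torusNorm x ^ 2 = ‖x.1‖ ^ 2 + ‖x.2‖ ^ 2 :=
  Real.sq_sqrt (by positivity)

theorem mem_disc_zero {x : Torus} {r : ℝ} : x ∈ disc 0 r ↔ torusNorm x < r := by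
  simp [disc, torusNorm]

theorem measurableSet_disc (r : ℝ) : MeasurableSet (disc 0 r) := by
  have : disc 0 r = torusNorm ⁻¹' Set.Iio r := by
    ext
    exact mem_disc_zero
  rw [this]
  exact (isOpen_Iio.preimage continuous_torusNorm).measurableSet

/-! ### Jackson-type kernels from the sixth power of a Dirichlet sum. -/

section Kernel

theorem finsupp_sum_single_mul {ι β : Type*} (s : Finset ι) (e : ι → β) (w : ι → ℂ)
    (χ : β → ℂ) :
    (∑ i ∈ s, Finsupp.single (e i) (w i)).sum (fun n a => a * χ n) = ∑ i ∈ s, w i * χ (e i) := by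
  rw [← Finsupp.sum_finsetSum_index (fun _ => zero_mul _) (fun _ _ _ => add_mul _ _ _)]
  exact Finset.sum_congr rfl fun i _ => Finsupp.sum_single_index (zero_mul _)

theorem finsupp_sum_sum_single_mul {ι β : Type*} (s t : Finset ι) (e : ι → ι → β)
    (w : ι → ι → ℂ) (χ : β → ℂ) :
    (∑ i ∈ s, ∑ j ∈ t, Finsupp.single (e i j) (w i j)).sum (fun n a => a * χ n) =
      ∑ i ∈ s, ∑ j ∈ t, w i j * χ (e i j) := by
  rw [← Finset.sum_product', ← Finset.sum_product']
  exact finsupp_sum_single_mul (s ×ˢ t) (fun p => e p.1 p.2) (fun p => w p.1 p.2) χ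

/-- `g` is a trigonometric polynomial of degree at most `d` in one variable. -/
def IsTrig (d : ℤ) (g : UnitAddCircle → ℂ) : Prop :=
  ∃ c : ℤ →₀ ℂ, (∀ n, d < |n| → c n = 0) ∧ ∀ t, g t = c.sum fun n a => a * fourier n t

theorem IsTrig.mul {d e : ℤ} {f g : UnitAddCircle → ℂ} (hf : IsTrig d f) (hg : IsTrig e g) :
    IsTrig (d + e) (fun t => f t * g t) := by
  obtain ⟨a, ha, ha'⟩ := hf
  obtain ⟨b, hb, hb'⟩ := hg
  refine ⟨∑ i ∈ a.support, ∑ j ∈ b.support, Finsupp.single (i + j) (a i * b j), ?_, ?_⟩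
  · intro n hn
    rw [Finsupp.finsetSum_apply]
    refine Finset.sum_eq_zero fun i hi => ?_
    rw [Finsupp.finsetSum_apply]
    refine Finset.sum_eq_zero fun j hj => ?_
    have h1 : |i| ≤ d := not_lt.1 fun h => Finsupp.mem_support_iff.1 hi (ha i h)
    have h2 : |j| ≤ e := not_lt.1 fun h => Finsupp.mem_support_iff.1 hj (hb j h)
    rw [Finsupp.single_apply, if_neg]
    rintro rfl
    have := abs_add_le i j
    linarith
  · intro t
    simp only [ha', hb']
    rw [finsupp_sum_sum_single_mul _ _ _ _ fun n => fourier n t, Finsupp.sum, Finsupp.sum, Finset.sum_mul_sum]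
    refine Finset.sum_congr rfl fun i _ => Finset.sum_congr rfl fun j _ => ?_
    rw [fourier_add]
    ring

theorem IsTrig.const (a : ℂ) : IsTrig 0 (fun _ => a) := by
  refine ⟨Finsupp.single 0 a, ?_, ?_⟩
  · intro n hn
    rw [Finsupp.single_apply, if_neg]
    rintro rfl
    simp at hn
  · intro t
    rw [Finsupp.sum_single_index (zero_mul _)]
    simp

theorem IsTrig.sum_fourier {d : ℤ} (s : Finset ℕ) (e : ℕ → ℤ) (he : ∀ i ∈ s, |e i| ≤ d) :
    IsTrig d (fun t => ∑ i ∈ s, (fourier (e i) t : ℂ)) := by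
  refine ⟨∑ i ∈ s, Finsupp.single (e i) 1, ?_, ?_⟩
  · intro n hn
    rw [Finsupp.finsetSum_apply]
    refine Finset.sum_eq_zero fun i hi => ?_
    rw [Finsupp.single_apply, if_neg]
    rintro rfl
    exact absurd (he i hi) (not_le.2 hn)
  · intro t
    rw [finsupp_sum_single_mul _ _ _ fun n => fourier n t]
    simp

/-- The Dirichlet sum `∑_{j < m} e^{2πijt}`. -/
def dirichletSum (m : ℕ) (t : UnitAddCircle) : ℂ := ∑ j ∈ Finset.range m, (fourier (j : ℤ) t : ℂ)

theorem continuous_dirichletSum (m : ℕ) : Continuous (dirichletSum m) := by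
  unfold dirichletSum
  fun_prop

theorem conj_dirichletSum (m : ℕ) (t : UnitAddCircle) :
    (starRingEnd ℂ) (dirichletSum m t) = ∑ j ∈ Finset.range m, (fourier (-(j : ℤ)) t : ℂ) := by
  rw [dirichletSum, map_sum]
  exact Finset.sum_congr rfl fun j _ => fourier_neg.symm

theorem integral_fourier_mul_conj_dirichletSum {m i : ℕ} (hi : i < m) :
    ∫ t, (fourier (i : ℤ) t : ℂ) * (starRingEnd ℂ) (dirichletSum m t) = 1 := by
  have h1 : ∀ t : UnitAddCircle, (fourier (i : ℤ) t : ℂ) * (starRingEnd ℂ) (dirichletSum m t) =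
      ∑ j ∈ Finset.range m, (fourier ((i : ℤ) - j) t : ℂ) := by
    intro t
    rw [conj_dirichletSum, Finset.mul_sum]
    refine Finset.sum_congr rfl fun j _ => ?_
    rw [sub_eq_add_neg, fourier_add]
  simp_rw [h1]
  rw [integral_finsetSum _ fun j _ => integrable_of_continuous (by fun_prop)]
  simp_rw [integral_fourier, sub_eq_zero, Nat.cast_inj]
  simp [hi]

theorem integral_norm_sq_dirichletSum (m : ℕ) : ∫ t, ‖dirichletSum m t‖ ^ 2 = m := by
  have hc := continuous_dirichletSum m
  have h1 : ((∫ t, ‖dirichletSum m t‖ ^ 2 : ℝ) : ℂ) = m := by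
    rw [← integral_complex_ofReal]
    have h2 : ∀ t, ((‖dirichletSum m t‖ ^ 2 : ℝ) : ℂ) = ∑ i ∈ Finset.range m,
        (fourier (i : ℤ) t : ℂ) * (starRingEnd ℂ) (dirichletSum m t) := by
      intro t
      rw [← Finset.sum_mul, ← dirichletSum, Complex.mul_conj, Complex.normSq_eq_norm_sq]
    simp_rw [h2]
    rw [integral_finsetSum _ fun i _ => integrable_of_continuous (by fun_prop),
      Finset.sum_congr rfl fun i hi =>
        integral_fourier_mul_conj_dirichletSum (Finset.mem_range.1 hi)]
    simp
  exact_mod_cast h1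

/-- Expanding the cube gives m³ frequencies i + j + k, all below 3m; each occurs once in the longer
Dirichlet sum and contributes 1. -/
theorem integral_cube_dirichletSum_mul (m : ℕ) :
    ∫ t, dirichletSum m t ^ 3 * (starRingEnd ℂ) (dirichletSum (3 * m) t) = (m : ℂ) ^ 3 := by
  have hc := continuous_dirichletSum (3 * m)
  have h1 : ∀ t, dirichletSum m t ^ 3 * (starRingEnd ℂ) (dirichletSum (3 * m) t) =
      ∑ i ∈ Finset.range m, ∑ j ∈ Finset.range m, ∑ k ∈ Finset.range m,
        (fourier ((i + j + k : ℕ) : ℤ) t : ℂ) * (starRingEnd ℂ) (dirichletSum (3 * m) t) := by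
    intro t
    have : dirichletSum m t ^ 3 = ∑ i ∈ Finset.range m, ∑ j ∈ Finset.range m,
        ∑ k ∈ Finset.range m, (fourier ((i + j + k : ℕ) : ℤ) t : ℂ) := by
      rw [pow_succ, sq, dirichletSum, Finset.sum_mul_sum, Finset.sum_mul]
      refine Finset.sum_congr rfl fun i _ => ?_
      rw [Finset.sum_mul]
      refine Finset.sum_congr rfl fun j _ => ?_
      rw [Finset.mul_sum]
      refine Finset.sum_congr rfl fun k _ => ?_
      push_cast
      rw [fourier_add, fourier_add]
    rw [this]
    simp_rw [Finset.sum_mul]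
  simp_rw [h1]
  have hint : ∀ n : ℕ, Integrable fun t : UnitAddCircle => (fourier (n : ℤ) t : ℂ) *
      (starRingEnd ℂ) (dirichletSum (3 * m) t) := fun n =>
    integrable_of_continuous (by fun_prop)
  rw [integral_finsetSum _ fun i _ => integrable_finsetSum _ fun j _ =>
    integrable_finsetSum _ fun k _ => hint _]
  calc _ = ∑ i ∈ Finset.range m, ∑ j ∈ Finset.range m, ∑ k ∈ Finset.range m, (1 : ℂ) := by
        refine Finset.sum_congr rfl fun i hi => ?_
        rw [integral_finsetSum _ fun j _ => integrable_finsetSum _ fun k _ => hint _]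
        refine Finset.sum_congr rfl fun j hj => ?_
        rw [integral_finsetSum _ fun k _ => hint _]
        refine Finset.sum_congr rfl fun k hk => ?_
        rw [Finset.mem_range] at hi hj hk
        exact integral_fourier_mul_conj_dirichletSum (by omega)
    _ = _ := by
        simp
        ring

/-- This is Cauchy–Schwarz for the cube against the Dirichlet sum of length 3m: m⁶ ≤ 3m ∫|D_m|⁶. It
is run pointwise through (|z| − c|w|)² ≥ 0 with the optimal c = m³/(3m). -/
theorem le_integral_norm_pow_six_dirichletSum (m : ℕ) :
    (m : ℝ) ^ 5 / 3 ≤ ∫ t, ‖dirichletSum m t‖ ^ 6 := by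
  have hc := continuous_dirichletSum m
  have hc3 := continuous_dirichletSum (3 * m)
  set c : ℝ := (m : ℝ) ^ 2 / 3 with hcdef
  have h1 : ∀ t, 2 * c * (dirichletSum m t ^ 3 *
      (starRingEnd ℂ) (dirichletSum (3 * m) t)).re - c ^ 2 * ‖dirichletSum (3 * m) t‖ ^ 2 ≤
      ‖dirichletSum m t‖ ^ 6 := by
    intro t
    set z := dirichletSum m t ^ 3
    set w := dirichletSum (3 * m) t
    have h2 : ‖dirichletSum m t‖ ^ 6 = ‖z‖ ^ 2 := by rw [norm_pow, ← pow_mul]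
    have h3 : (z * (starRingEnd ℂ) w).re ≤ ‖z‖ * ‖w‖ := by
      refine (Complex.re_le_norm _).trans (le_of_eq ?_)
      rw [norm_mul, RCLike.norm_conj]
    have h4 : 0 ≤ c := by positivity
    rw [h2]
    nlinarith [mul_le_mul_of_nonneg_left h3 h4, sq_nonneg (‖z‖ - c * ‖w‖)]
  have h5 : ∫ t, (dirichletSum m t ^ 3 * (starRingEnd ℂ) (dirichletSum (3 * m) t)).re =
      (m : ℝ) ^ 3 := by
    have h6 : Integrable fun t => dirichletSum m t ^ 3 *
        (starRingEnd ℂ) (dirichletSum (3 * m) t) := integrable_of_continuous (by fun_prop)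
    have := integral_re h6
    simp only [RCLike.re_to_complex] at this
    rw [this, integral_cube_dirichletSum_mul]
    have : ((m : ℂ) ^ 3) = ((m ^ 3 : ℝ) : ℂ) := by push_cast; rfl
    rw [this, Complex.ofReal_re]
  have h7 : Integrable fun t => 2 * c * (dirichletSum m t ^ 3 *
      (starRingEnd ℂ) (dirichletSum (3 * m) t)).re :=
    integrable_of_continuous_real (by fun_prop)
  have h8 : Integrable fun t => c ^ 2 * ‖dirichletSum (3 * m) t‖ ^ 2 :=
    integrable_of_continuous_real (by fun_prop)
  have h9 := integral_mono (h7.sub h8) (integrable_of_continuous_real (by fun_prop)) h1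
  simp only [Pi.sub_apply] at h9
  rw [integral_sub h7 h8, integral_const_mul, integral_const_mul, h5,
    integral_norm_sq_dirichletSum] at h9
  refine le_trans (le_of_eq ?_) h9
  rw [hcdef]
  push_cast
  ring

/-- On the representative with |y| ≤ 1/2 the right side is 2|sin πy|, and Jordan's inequality
applies. -/
theorem norm_le_norm_one_sub_fourier (t : UnitAddCircle) :
    4 * ‖t‖ ≤ ‖1 - (fourier 1 t : ℂ)‖ := by
  obtain ⟨x, rfl⟩ := QuotientAddGroup.mk_surjective t
  set y : ℝ := x - round x with hy
  have hxy : ((x : ℝ) : UnitAddCircle) = (y : UnitAddCircle) := by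
    rw [hy, AddCircle.coe_sub, eq_comm, sub_eq_self, AddCircle.coe_eq_zero_iff]
    exact ⟨round x, by simp⟩
  change 4 * ‖((x : ℝ) : UnitAddCircle)‖ ≤ ‖1 - (fourier 1 ((x : ℝ) : UnitAddCircle) : ℂ)‖
  have hyabs : |y| ≤ 1 / 2 := abs_sub_round x
  rw [UnitAddCircle.norm_eq, ← hy, hxy, fourier_coe_apply]
  have h1 : (2 * Real.pi * Complex.I * ((1 : ℤ) : ℂ) * y / ((1 : ℝ) : ℂ) : ℂ) =
      Complex.I * ((2 * Real.pi * y : ℝ) : ℂ) := by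
    push_cast
    ring
  rw [h1, norm_sub_rev, Complex.norm_exp_I_mul_ofReal_sub_one]
  have h2 := Real.mul_abs_le_abs_sin (x := Real.pi * y) (by
    rw [abs_mul, abs_of_pos Real.pi_pos]
    nlinarith [Real.pi_pos])
  rw [abs_mul, abs_of_pos Real.pi_pos, ← mul_assoc, div_mul_cancel₀ _ Real.pi_ne_zero] at h2
  rw [norm_mul, Real.norm_eq_abs, Real.norm_eq_abs, show 2 * Real.pi * y / 2 = Real.pi * y by ring,
    abs_two]
  linarith

theorem one_sub_fourier_mul_dirichletSum (m : ℕ) (t : UnitAddCircle) :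
    (1 - (fourier 1 t : ℂ)) * dirichletSum m t = 1 - (fourier (m : ℤ) t : ℂ) := by
  induction m with
  | zero => simp [dirichletSum]
  | succ m ih =>
    rw [dirichletSum, Finset.sum_range_succ, ← dirichletSum, mul_add, ih]
    push_cast
    rw [fourier_add]
    ring

/-- Summing the geometric series gives ‖t‖ |D_m(t)| ≤ 1/2. Four of the six factors absorb ‖t‖⁴, and
the remaining square has integral m. -/
theorem integral_norm_pow_four_mul_le (m : ℕ) :
    ∫ t, ‖t‖ ^ 4 * ‖dirichletSum m t‖ ^ 6 ≤ (m : ℝ) / 16 := by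
  have hc := continuous_dirichletSum m
  have h1 : ∀ t, ‖t‖ ^ 4 * ‖dirichletSum m t‖ ^ 6 ≤ 1 / 16 * ‖dirichletSum m t‖ ^ 2 := by
    intro t
    have h2 : 4 * ‖t‖ * ‖dirichletSum m t‖ ≤ 2 := by
      calc 4 * ‖t‖ * ‖dirichletSum m t‖ ≤ ‖1 - (fourier 1 t : ℂ)‖ * ‖dirichletSum m t‖ := by
            gcongr
            exact norm_le_norm_one_sub_fourier t
        _ = ‖1 - (fourier (m : ℤ) t : ℂ)‖ := by
            rw [← norm_mul, one_sub_fourier_mul_dirichletSum]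
        _ ≤ ‖(1 : ℂ)‖ + ‖(fourier (m : ℤ) t : ℂ)‖ := norm_sub_le _ _
        _ = 2 := by
            rw [fourier_apply, Circle.norm_coe]
            norm_num
    have h3 : (‖t‖ * ‖dirichletSum m t‖) ^ 4 ≤ (1 / 2) ^ 4 :=
      pow_le_pow_left₀ (by positivity) (by linarith) 4
    calc _ = (‖t‖ * ‖dirichletSum m t‖) ^ 4 * ‖dirichletSum m t‖ ^ 2 := by ring
      _ ≤ (1 / 2) ^ 4 * ‖dirichletSum m t‖ ^ 2 := by gcongr
      _ = _ := by ring
  have h4 := integral_mono (integrable_of_continuous_real (by fun_prop))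
    (integrable_of_continuous_real (by fun_prop)) h1
  rw [integral_const_mul, integral_norm_sq_dirichletSum] at h4
  linarith

/-- A one-dimensional kernel of Jackson type. -/
theorem exists_kernel_circle {m : ℕ} (hm : 0 < m) :
    ∃ k : UnitAddCircle → ℝ, Continuous k ∧ (∀ t, 0 ≤ k t) ∧ ∫ t, k t = 1 ∧
      ∫ t, ‖t‖ ^ 4 * k t ≤ 1 / (4 * m ^ 4 : ℝ) ∧
      IsTrig (6 * (m - 1)) (fun t => (k t : ℂ)) := by
  have hc := continuous_dirichletSum m
  set Z := ∫ t, ‖dirichletSum m t‖ ^ 6 with hZ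
  have hZm := le_integral_norm_pow_six_dirichletSum m
  rw [← hZ] at hZm
  have hmR : (0 : ℝ) < m := by exact_mod_cast hm
  have hZ0 : 0 < Z := lt_of_lt_of_le (by positivity) hZm
  refine ⟨fun t => Z⁻¹ * ‖dirichletSum m t‖ ^ 6, by fun_prop, fun t => by positivity, ?_, ?_, ?_⟩
  · rw [integral_const_mul, ← hZ, inv_mul_cancel₀ hZ0.ne']
  · have h1 := integral_norm_pow_four_mul_le m
    calc ∫ t, ‖t‖ ^ 4 * (Z⁻¹ * ‖dirichletSum m t‖ ^ 6) =
          Z⁻¹ * ∫ t, ‖t‖ ^ 4 * ‖dirichletSum m t‖ ^ 6 := by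
          rw [← integral_const_mul]
          congr 1
          ext t
          ring
      _ ≤ ((m : ℝ) ^ 5 / 3)⁻¹ * ((m : ℝ) / 16) := by gcongr
      _ ≤ _ := by
          rw [inv_mul_eq_div, div_div_eq_mul_div, div_le_div_iff₀ (by positivity) (by positivity)]
          have : 0 < (m : ℝ) ^ 5 := by positivity
          nlinarith
  -- |D_m|⁶ is the cube of the product of D_m and its conjugate: six factors of degree m − 1.
  · have hP : IsTrig (m - 1) (dirichletSum m) :=
      IsTrig.sum_fourier (Finset.range m) (fun j => (j : ℤ)) fun j hj => by
        rw [Finset.mem_range] at hj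
        rw [abs_of_nonneg (by positivity)]
        omega
    have hP' : IsTrig (m - 1) (fun t => (starRingEnd ℂ) (dirichletSum m t)) := by
      simp_rw [conj_dirichletSum]
      refine IsTrig.sum_fourier (Finset.range m) (fun j => -(j : ℤ)) fun j hj => ?_
      rw [Finset.mem_range] at hj
      rw [abs_neg, abs_of_nonneg (by positivity)]
      omega
    have h2 := hP.mul hP'
    have h3 := (IsTrig.const ((Z⁻¹ : ℝ) : ℂ)).mul ((h2.mul h2).mul h2)
    convert h3 using 1
    · ring
    · ext t
      simp only [Complex.mul_conj, Complex.normSq_eq_norm_sq]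
      push_cast
      ring

/-- Non-negative trigonometric polynomials of degree less than `d` and mass one that are
concentrated at scale `1 / d`. -/
theorem exists_kernel :
    ∃ C : ℝ, 0 < C ∧ ∀ d : ℝ, 0 < d → ∃ (K : TrigPoly) (k : Torus → ℝ), Continuous k ∧
      (∀ x, 0 ≤ k x) ∧ (∀ x, K.eval x = (k x : ℂ)) ∧ ∫ x, k x = 1 ∧
      (∀ n : ℤ × ℤ, d ≤ √((n.1 : ℝ) ^ 2 + (n.2 : ℝ) ^ 2) → K n = 0) ∧
      ∫ x, torusNorm x ^ 4 * k x ≤ C / d ^ 4 := by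
  refine ⟨12 ^ 4, by norm_num, fun d hd => ?_⟩
  -- Then 6(m − 1) < d/2 bounds the degree in each variable, so the Euclidean degree stays below d,
  -- while m ≥ d/12 turns m⁻⁴ into 12⁴/d⁴.
  set m := ⌈d / 12⌉₊ with hm
  have hm0 : 0 < m := Nat.ceil_pos.2 (by positivity)
  have hmd : d / 12 ≤ m := Nat.le_ceil _
  have hmd' : (m : ℝ) - 1 < d / 12 := by
    have := Nat.ceil_lt_add_one (a := d / 12) (by positivity)
    rw [← hm] at this
    linarith
  obtain ⟨k, hkc, hk0, hk1, hk4, c, hc, hck⟩ := exists_kernel_circle hm0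
  -- The index (−i, j) reflects the symplectic convention n₂x₁ − n₁x₂ of the characters.
  refine ⟨∑ i ∈ c.support, ∑ j ∈ c.support, Finsupp.single (-i, j) (c i * c j),
    fun x => k x.1 * k x.2, by fun_prop, fun x => mul_nonneg (hk0 _) (hk0 _), ?_, ?_, ?_, ?_⟩
  · intro x
    rw [TrigPoly.eval, finsupp_sum_sum_single_mul _ _ _ _ fun n => character n x]
    have hck' : ∀ t, (k t : ℂ) = c.sum fun n a => a * fourier n t := hck
    push_cast
    rw [hck', hck', mul_comm, Finsupp.sum, Finsupp.sum, Finset.sum_mul_sum]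
    refine Finset.sum_congr rfl fun i _ => Finset.sum_congr rfl fun j _ => ?_
    simp only [character, neg_neg]
    ring
  · rw [Measure.volume_eq_prod, integral_prod_mul, hk1, one_mul]
  · intro n hn
    rw [Finsupp.finsetSum_apply]
    refine Finset.sum_eq_zero fun i hi => ?_
    rw [Finsupp.finsetSum_apply]
    refine Finset.sum_eq_zero fun j hj => ?_
    have h1 : |i| ≤ 6 * (m - 1) := not_lt.1 fun h => Finsupp.mem_support_iff.1 hi (hc i h)
    have h2 : |j| ≤ 6 * (m - 1) := not_lt.1 fun h => Finsupp.mem_support_iff.1 hj (hc j h)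
    have h1' : |(i : ℝ)| ≤ d / 2 := by
      have : |(i : ℝ)| ≤ 6 * (m - 1) := by exact_mod_cast h1
      linarith
    have h2' : |(j : ℝ)| ≤ d / 2 := by
      have : |(j : ℝ)| ≤ 6 * (m - 1) := by exact_mod_cast h2
      linarith
    rw [Finsupp.single_apply, if_neg]
    rintro rfl
    refine absurd hn (not_le.2 ?_)
    rw [Real.sqrt_lt' hd]
    push_cast
    rw [neg_sq]
    have h3 := sq_le_sq' (by linarith [abs_nonneg (i : ℝ)]) h1'
    have h4 := sq_le_sq' (by linarith [abs_nonneg (j : ℝ)]) h2'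
    rw [sq_abs] at h3 h4
    nlinarith
  · have h1 : ∀ x : Torus, torusNorm x ^ 4 * (k x.1 * k x.2) ≤
        2 * ((‖x.1‖ ^ 4 * k x.1) * k x.2) + 2 * (k x.1 * (‖x.2‖ ^ 4 * k x.2)) := by
      intro x
      have h2 : torusNorm x ^ 4 ≤ 2 * (‖x.1‖ ^ 4 + ‖x.2‖ ^ 4) := by
        rw [show torusNorm x ^ 4 = (torusNorm x ^ 2) ^ 2 by ring, torusNorm_sq]
        nlinarith [sq_nonneg (‖x.1‖ ^ 2 - ‖x.2‖ ^ 2)]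
      have h3 := mul_le_mul_of_nonneg_right h2 (mul_nonneg (hk0 x.1) (hk0 x.2))
      linarith
    have hcn := continuous_torusNorm
    have h4 := integral_mono (integrable_torus (by fun_prop)) (integrable_torus (by fun_prop)) h1
    have e1 : ∫ x : Torus, (‖x.1‖ ^ 4 * k x.1) * k x.2 = ∫ t, ‖t‖ ^ 4 * k t := by
      rw [Measure.volume_eq_prod, integral_prod_mul (fun t => ‖t‖ ^ 4 * k t) k, hk1, mul_one]
    have e2 : ∫ x : Torus, k x.1 * (‖x.2‖ ^ 4 * k x.2) = ∫ t, ‖t‖ ^ 4 * k t := by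
      rw [Measure.volume_eq_prod, integral_prod_mul k (fun t => ‖t‖ ^ 4 * k t), hk1, one_mul]
    rw [integral_add (integrable_torus (by fun_prop)) (integrable_torus (by fun_prop)),
      integral_const_mul, integral_const_mul, e1, e2] at h4
    have hmR : (0 : ℝ) < m := by exact_mod_cast hm0
    calc _ ≤ _ := h4
      _ ≤ 2 * (1 / (4 * m ^ 4 : ℝ)) + 2 * (1 / (4 * m ^ 4 : ℝ)) := by gcongr
      _ = 1 / (m : ℝ) ^ 4 := by ring
      _ ≤ 1 / (d / 12) ^ 4 := by gcongr
      _ = _ := by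
        rw [div_pow, one_div_div]

end Kernel

/-! ### Convolution with trigonometric kernels. -/

/-- The convolution of a trigonometric polynomial with an integrable function. -/
def TrigPoly.conv (K : TrigPoly) (f : Torus → ℝ) : TrigPoly :=
  Finsupp.onFinset K.support (fun n => K n * ∫ y, (f y : ℂ) * character n (-y)) fun _ hn =>
    Finsupp.mem_support_iff.2 (left_ne_zero_of_mul hn)

theorem TrigPoly.conv_apply (K : TrigPoly) (f : Torus → ℝ) (n : ℤ × ℤ) :
    K.conv f n = K n * ∫ y, (f y : ℂ) * character n (-y) := rfl

theorem TrigPoly.conv_apply_zero (K : TrigPoly) (f : Torus → ℝ) :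
    K.conv f 0 = K 0 * ((∫ y, f y : ℝ) : ℂ) := by
  simp [TrigPoly.conv_apply, character_zero, integral_complex_ofReal]

theorem TrigPoly.norm_conv_apply_le (K : TrigPoly) (f : Torus → ℝ) (n : ℤ × ℤ) :
    ‖K.conv f n‖ ≤ ‖K n‖ * ∫ y, |f y| := by
  rw [TrigPoly.conv_apply, norm_mul]
  gcongr
  refine (norm_integral_le_integral_norm _).trans (le_of_eq ?_)
  simp [norm_character]

theorem integrable_mul_sub {f k : Torus → ℝ} (hf : Integrable f) (hk : Continuous k) (x : Torus) :
    Integrable fun y => f y * k (x - y) := by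
  obtain ⟨C, hC⟩ := isCompact_univ.exists_bound_of_continuousOn
    (f := fun y => k (x - y)) (by fun_prop)
  exact hf.mul_bdd (c := C) (by fun_prop : Continuous fun y => k (x - y)).aestronglyMeasurable
    (Eventually.of_forall fun y => hC y (Set.mem_univ y))

theorem character_sub (n : ℤ × ℤ) (x y : Torus) :
    character n (x - y) = character n (-y) * character n x := by
  simp only [character, fourier_apply, Prod.fst_neg, Prod.snd_neg,
    sub_eq_neg_add, Prod.fst_add, Prod.snd_add, smul_add, AddCircle.toCircle_add, Circle.coe_mul]
  ring

theorem TrigPoly.eval_conv {K : TrigPoly} {k : Torus → ℝ} (hK : ∀ x, K.eval x = (k x : ℂ))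
    {f : Torus → ℝ} (hf : Integrable f) (x : Torus) :
    (K.conv f).eval x = ((∫ y, f y * k (x - y) : ℝ) : ℂ) := by
  have hsub : (K.conv f).support ⊆ K.support := Finsupp.support_onFinset_subset
  have hint : ∀ n, Integrable fun y => (f y : ℂ) * character n (-y) := fun n =>
    hf.ofReal.mul_bdd (c := 1) ((continuous_character n).comp continuous_neg).aestronglyMeasurable
      (Eventually.of_forall fun y => (norm_character n _).le)
  have h1 : ∀ y, ((f y * k (x - y) : ℝ) : ℂ) =
      ∑ n ∈ K.support, K n * character n x * ((f y : ℂ) * character n (-y)) := by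
    intro y
    rw [Complex.ofReal_mul, ← hK, TrigPoly.eval, Finsupp.sum, Finset.mul_sum]
    refine Finset.sum_congr rfl fun n _ => ?_
    rw [character_sub]
    ring
  rw [TrigPoly.eval, Finsupp.sum_of_support_subset _ hsub _ (by simp), ← integral_complex_ofReal]
  simp_rw [h1]
  rw [integral_finsetSum _ fun n _ => (hint n).const_mul _]
  refine Finset.sum_congr rfl fun n _ => ?_
  rw [integral_const_mul, TrigPoly.conv_apply]
  ring

theorem norm_apply_le_one {K : TrigPoly} {k : Torus → ℝ} (hK : ∀ x, K.eval x = (k x : ℂ))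
    (hk0 : ∀ x, 0 ≤ k x) (hk1 : ∫ x, k x = 1) (n : ℤ × ℤ) : ‖K n‖ ≤ 1 := by
  rw [K.apply_eq_integral]
  refine (norm_integral_le_integral_norm _).trans (le_of_eq (Eq.trans ?_ hk1))
  congr 1
  ext x
  rw [norm_mul, norm_character, hK, mul_one, Complex.norm_real, Real.norm_of_nonneg (hk0 x)]

theorem apply_zero_eq_one {K : TrigPoly} {k : Torus → ℝ} (hK : ∀ x, K.eval x = (k x : ℂ))
    (hk1 : ∫ x, k x = 1) : K 0 = 1 := by
  rw [K.apply_eq_integral]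
  simp only [neg_zero, character_zero, mul_one, hK]
  rw [integral_complex_ofReal, hk1, Complex.ofReal_one]

/-! ### The area of a small disc. -/

/-- For r ≤ 1/2 the disc does not wrap around: in the fundamental square centred at 0 it is the
Euclidean disc, whose area is known in ℂ. -/
theorem volume_disc_eq {r : ℝ} (hr0 : 0 ≤ r) (hr : r ≤ 1 / 2) :
    volume.real (disc (0 : Torus) r) = Real.pi * r ^ 2 := by
  set I : Set ℝ := Set.Ioc (-(1 / 2) : ℝ) (-(1 / 2) + 1)
  have hmp := (UnitAddCircle.measurePreserving_mk (-(1 / 2))).prod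
    (UnitAddCircle.measurePreserving_mk (-(1 / 2)))
  have hnorm : ∀ x : ℝ, |x| ≤ 1 / 2 → ‖(x : UnitAddCircle)‖ = |x| := fun x hx =>
    (AddCircle.norm_coe_eq_abs_iff 1 one_ne_zero).2 (by rwa [abs_one])
  have h1 := hmp.measure_preimage (measurableSet_disc r).nullMeasurableSet
  rw [Measure.prod_restrict, Measure.restrict_apply (hmp.measurable (measurableSet_disc r))] at h1
  have h2 : (Prod.map (QuotientAddGroup.mk : ℝ → UnitAddCircle) QuotientAddGroup.mk ⁻¹'
      disc 0 r) ∩ I ×ˢ I = Complex.measurableEquivRealProd.symm ⁻¹' Metric.ball 0 r := by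
    have hI : ∀ x ∈ I, |x| ≤ 1 / 2 := by
      intro x hx
      rw [abs_le]
      exact ⟨hx.1.le, by linarith [hx.2]⟩
    ext ⟨x, y⟩
    have hz : ‖Complex.measurableEquivRealProd.symm (x, y)‖ = √(x ^ 2 + y ^ 2) := by
      rw [Complex.norm_eq_sqrt_sq_add_sq]
      rfl
    simp only [Set.mem_inter_iff, Set.mem_preimage, mem_disc_zero, Set.mem_prod,
      Metric.mem_ball, dist_zero_right, hz, Prod.map, torusNorm]
    constructor
    · rintro ⟨h3, hx, hy⟩
      have ex := hnorm x (hI x hx)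
      have ey := hnorm y (hI y hy)
      rw [← sq_abs x, ← sq_abs y, ← ex, ← ey]
      exact h3
    · intro h3
      have hx : |x| < 1 / 2 :=
        (Real.abs_le_sqrt (by nlinarith [sq_nonneg y])).trans_lt (h3.trans_le hr)
      have hy : |y| < 1 / 2 :=
        (Real.abs_le_sqrt (by nlinarith [sq_nonneg x])).trans_lt (h3.trans_le hr)
      have ex := hnorm x hx.le
      have ey := hnorm y hy.le
      rw [← sq_abs x, ← sq_abs y, ← ex, ← ey] at h3
      rw [abs_lt] at hx hy
      exact ⟨h3, ⟨hx.1, by linarith⟩, ⟨hy.1, by linarith⟩⟩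
  have h3 := (Complex.volume_preserving_equiv_real_prod.symm _).measure_preimage
    (Metric.isOpen_ball (x := (0 : ℂ)) (ε := r)).measurableSet.nullMeasurableSet
  have h4 : volume (disc (0 : Torus) r) = volume (Metric.ball (0 : ℂ) r) := by
    rw [← h3]
    refine h1.symm.trans ?_
    exact congrArg _ h2
  rw [measureReal_def, h4, Complex.volume_ball]
  simp [ENNReal.toReal_ofReal hr0, mul_comm]

/-! ### A slowly varying weight controlling the tail of the minorant. -/

section Weight

/-- The Cauchy profile at scale `r`. -/
def cauchyProfile (r : ℝ) (t : UnitAddCircle) : ℝ := r ^ 2 / (r ^ 2 + ‖t‖ ^ 2)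

/-- A weight of mass `O(r²)` that decays like `(r / |x|)⁴` at worst. -/
def cauchyWeight (r : ℝ) (x : Torus) : ℝ := cauchyProfile r x.1 * cauchyProfile r x.2

variable {r : ℝ}

theorem cauchyProfile_pos (hr : 0 < r) (t : UnitAddCircle) : 0 < cauchyProfile r t := by
  unfold cauchyProfile
  positivity

theorem cauchyWeight_pos (hr : 0 < r) (x : Torus) : 0 < cauchyWeight r x :=
  mul_pos (cauchyProfile_pos hr _) (cauchyProfile_pos hr _)

theorem continuous_cauchyProfile (hr : 0 < r) : Continuous (cauchyProfile r) := by
  unfold cauchyProfile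
  exact continuous_const.div (by fun_prop) fun t => by positivity

theorem continuous_cauchyWeight (hr : 0 < r) : Continuous (cauchyWeight r) := by
  have := continuous_cauchyProfile hr
  unfold cauchyWeight
  fun_prop

/-- The integral over one period is extended to the whole line, where it is that of the Cauchy
density. -/
theorem integral_cauchyProfile_le (hr : 0 < r) : ∫ t, cauchyProfile r t ≤ Real.pi * r := by
  have hform : ∀ x : ℝ, (1 + (x / r) ^ 2)⁻¹ = r ^ 2 / (r ^ 2 + x ^ 2) := by
    intro x
    rw [div_pow, ← one_div, one_add_div (by positivity), one_div_div]
  rw [← UnitAddCircle.integral_preimage (-(1 / 2))]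
  calc ∫ a in Set.Ioc (-(1 / 2) : ℝ) (-(1 / 2) + 1), cauchyProfile r (a : UnitAddCircle) =
        ∫ a in Set.Ioc (-(1 / 2) : ℝ) (-(1 / 2) + 1), (1 + (a / r) ^ 2)⁻¹ := by
        refine setIntegral_congr_fun measurableSet_Ioc fun a ha => ?_
        have h1 : ‖(a : UnitAddCircle)‖ = |a| :=
          (AddCircle.norm_coe_eq_abs_iff 1 one_ne_zero).2 (by
            rw [abs_one, abs_le]
            exact ⟨ha.1.le, by linarith [ha.2]⟩)
        simp only [cauchyProfile, h1, sq_abs, hform]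
    _ ≤ ∫ a : ℝ, (1 + (a / r) ^ 2)⁻¹ :=
        setIntegral_le_integral (integrable_inv_one_add_sq.comp_div hr.ne')
          (Eventually.of_forall fun a => by positivity)
    _ = Real.pi * r := by
        rw [Measure.integral_comp_div (fun x : ℝ => (1 + x ^ 2)⁻¹) r, integral_univ_inv_one_add_sq,
          abs_of_pos hr, smul_eq_mul, mul_comm]

theorem integral_cauchyWeight_le (hr : 0 < r) : ∫ x, cauchyWeight r x ≤ (Real.pi * r) ^ 2 := by
  unfold cauchyWeight
  rw [Measure.volume_eq_prod, integral_prod_mul, sq]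
  have h0 : 0 ≤ ∫ t, cauchyProfile r t := integral_nonneg fun t => (cauchyProfile_pos hr t).le
  exact mul_le_mul (integral_cauchyProfile_le hr) (integral_cauchyProfile_le hr) h0 (by positivity)

/-- Slow variation at scale r, from ‖t‖² ≤ 2‖s‖² + 2r²; it lets the weight survive smoothing. -/
theorem cauchyProfile_le (hr : 0 < r) {s t : UnitAddCircle} (hst : ‖s - t‖ ≤ r) :
    cauchyProfile r s ≤ 3 * cauchyProfile r t := by
  have h1 : ‖t‖ ≤ ‖s‖ + ‖s - t‖ := by
    have := norm_sub_le s (s - t)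
    rwa [sub_sub_cancel] at this
  have h2 : ‖t‖ ^ 2 ≤ 2 * ‖s‖ ^ 2 + 2 * r ^ 2 := by
    nlinarith [norm_nonneg t, norm_nonneg s, sq_nonneg (‖s‖ - r)]
  unfold cauchyProfile
  rw [← mul_div_assoc, div_le_div_iff₀ (by positivity) (by positivity)]
  nlinarith [sq_nonneg r, mul_nonneg (sq_nonneg r) (sq_nonneg r)]

theorem cauchyWeight_le (hr : 0 < r) {x y : Torus} (hxy : torusNorm (x - y) ≤ r) :
    cauchyWeight r x ≤ 9 * cauchyWeight r y := by
  have h0 := torusNorm_sq (x - y)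
  have hn := torusNorm_nonneg (x - y)
  have h1 : ‖x.1 - y.1‖ ≤ r :=
    (Real.le_sqrt_of_sq_le (le_add_of_nonneg_right (sq_nonneg _))).trans hxy
  have h2 : ‖x.2 - y.2‖ ≤ r :=
    (Real.le_sqrt_of_sq_le (le_add_of_nonneg_left (sq_nonneg _))).trans hxy
  have h3 := mul_le_mul (cauchyProfile_le hr h1) (cauchyProfile_le hr h2)
    (cauchyProfile_pos hr _).le (mul_pos three_pos (cauchyProfile_pos hr _)).le
  unfold cauchyWeight
  linarith

/-- Outside the disc each of the two denominators is at most 2|x|². -/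
theorem le_cauchyWeight (hr : 0 < r) {x : Torus} (hx : r ≤ torusNorm x) :
    (r / torusNorm x) ^ 4 ≤ 4 * cauchyWeight r x := by
  have hx0 : 0 < torusNorm x := hr.trans_le hx
  set ρ := torusNorm x
  have h1 : cauchyWeight r x = r ^ 4 / ((r ^ 2 + ‖x.1‖ ^ 2) * (r ^ 2 + ‖x.2‖ ^ 2)) := by
    unfold cauchyWeight cauchyProfile
    rw [div_mul_div_comm]
    ring
  have h2 : ρ ^ 2 = ‖x.1‖ ^ 2 + ‖x.2‖ ^ 2 := torusNorm_sq x
  have h3 : r ^ 2 ≤ ρ ^ 2 := by gcongr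
  have h4 : (r ^ 2 + ‖x.1‖ ^ 2) * (r ^ 2 + ‖x.2‖ ^ 2) ≤ 4 * ρ ^ 4 := by
    have h5 : (r ^ 2 + ‖x.1‖ ^ 2) * (r ^ 2 + ‖x.2‖ ^ 2) ≤ (2 * ρ ^ 2) * (2 * ρ ^ 2) := by
      gcongr <;> nlinarith [sq_nonneg ‖x.1‖, sq_nonneg ‖x.2‖]
    linarith
  rw [h1, div_pow, ← mul_div_assoc, div_le_div_iff₀ (by positivity) (by positivity)]
  nlinarith [pow_pos hr 4]

end Weight

/-! ### Effect of smoothing on discs and on the weight. -/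

section Concentration

variable {k : Torus → ℝ} {B r ε : ℝ}

theorem integral_sub_torus (g : Torus → ℝ) (x : Torus) : ∫ y, g (x - y) = ∫ y, g y :=
  integral_sub_left_eq_self g volume x

/-- Convolution with a concentrated kernel at points of the disc. -/
theorem le_integral_disc_mul (hkc : Continuous k) (hk0 : ∀ x, 0 ≤ k x) (hk1 : ∫ x, k x = 1)
    (hB : ∫ x, torusNorm x ^ 4 * k x ≤ B) {s : ℝ} (hs : 0 < s) {x : Torus}
    (hx : x ∈ disc 0 r) :
    1 - B / s ^ 4 ≤ ∫ y, (disc 0 (r + s)).indicator (fun _ => (1 : ℝ)) y * k (x - y) := by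
  have hn := continuous_torusNorm
  have hi := integrable_mul_sub (k := k) ((integrable_const (1 : ℝ)).indicator
    (measurableSet_disc (r + s))) hkc x
  -- A pointwise Chebyshev inequality: if y is outside the enlarged disc, then |x − y| ≥ s and the
  -- left side is not positive.
  have hpt : ∀ y, k (x - y) - 1 / s ^ 4 * (torusNorm (x - y) ^ 4 * k (x - y)) ≤
      (disc 0 (r + s)).indicator (fun _ => (1 : ℝ)) y * k (x - y) := by
    intro y
    have hk := hk0 (x - y)
    by_cases hy : y ∈ disc 0 (r + s)
    · rw [Set.indicator_of_mem hy, one_mul]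
      have := torusNorm_nonneg (x - y)
      have : 0 ≤ 1 / s ^ 4 * (torusNorm (x - y) ^ 4 * k (x - y)) := by positivity
      linarith
    · rw [Set.indicator_of_notMem hy, zero_mul]
      rw [mem_disc_zero, not_lt] at hy
      rw [mem_disc_zero] at hx
      have h1 : s ≤ torusNorm (x - y) := by
        have h2 := torusNorm_add_le x (-(x - y))
        rw [show x + -(x - y) = y by abel] at h2
        have h3 : torusNorm (-(x - y)) = torusNorm (x - y) := by
          simp only [torusNorm, Prod.fst_neg, Prod.snd_neg, norm_neg]
        linarith
      have h4 : 1 ≤ 1 / s ^ 4 * torusNorm (x - y) ^ 4 := by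
        rw [one_div_mul_eq_div, one_le_div (by positivity)]
        gcongr
      nlinarith
  have h5 := integral_mono (integrable_torus (by fun_prop)) hi hpt
  rw [integral_sub (integrable_torus (by fun_prop)) (integrable_torus (by fun_prop)),
    integral_const_mul, integral_sub_torus k, integral_sub_torus (fun z => torusNorm z ^ 4 * k z),
    hk1] at h5
  refine le_trans ?_ h5
  rw [div_eq_mul_one_div, mul_comm]
  gcongr

/-- Convolution with a concentrated kernel at points outside the disc. -/
theorem integral_disc_mul_le (hkc : Continuous k) (hk0 : ∀ x, 0 ≤ k x)
    (hB : ∫ x, torusNorm x ^ 4 * k x ≤ B) (hr : 0 < r) (hε : 0 < ε) (hε1 : ε ≤ 1) {x : Torus}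
    (hx : x ∉ disc 0 r) :
    ∫ y, (disc 0 (r * (1 - ε))).indicator (fun _ => (1 : ℝ)) y * k (x - y) ≤
      B / (ε * torusNorm x) ^ 4 := by
  have hn := continuous_torusNorm
  have hi := integrable_mul_sub (k := k) ((integrable_const (1 : ℝ)).indicator
    (measurableSet_disc (r * (1 - ε)))) hkc x
  rw [mem_disc_zero, not_lt] at hx
  have hx0 : 0 < torusNorm x := hr.trans_le hx
  have hpt : ∀ y, (disc 0 (r * (1 - ε))).indicator (fun _ => (1 : ℝ)) y * k (x - y) ≤
      1 / (ε * torusNorm x) ^ 4 * (torusNorm (x - y) ^ 4 * k (x - y)) := by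
    intro y
    have hk := hk0 (x - y)
    by_cases hy : y ∈ disc 0 (r * (1 - ε))
    · rw [Set.indicator_of_mem hy, one_mul]
      rw [mem_disc_zero] at hy
      -- Here |x − y| ≥ |x| − r(1 − ε) ≥ ε|x| because r ≤ |x|. A separation proportional to |x|
      -- produces the decay |x|⁻⁴.
      have h1 : ε * torusNorm x ≤ torusNorm (x - y) := by
        have h2 := torusNorm_add_le (x - y) y
        rw [sub_add_cancel] at h2
        nlinarith
      have h4 : 1 ≤ 1 / (ε * torusNorm x) ^ 4 * torusNorm (x - y) ^ 4 := by
        rw [one_div_mul_eq_div, one_le_div (by positivity)]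
        gcongr
      nlinarith
    · rw [Set.indicator_of_notMem hy, zero_mul]
      have := torusNorm_nonneg (x - y)
      positivity
  have h5 := integral_mono hi (integrable_torus (by fun_prop)) hpt
  rw [integral_const_mul, integral_sub_torus (fun z => torusNorm z ^ 4 * k z)] at h5
  refine h5.trans ?_
  rw [div_eq_mul_one_div B, mul_comm]
  gcongr

/-- All but B/r⁴ of the kernel's mass lies within distance r, where the weight drops by a factor of
at most 9. -/
theorem cauchyWeight_le_integral_mul (hkc : Continuous k) (hk0 : ∀ x, 0 ≤ k x)
    (hk1 : ∫ x, k x = 1) (hB : ∫ x, torusNorm x ^ 4 * k x ≤ B) (hr : 0 < r) (x : Torus) :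
    cauchyWeight r x / 9 * (1 - B / r ^ 4) ≤ ∫ y, cauchyWeight r y * k (x - y) := by
  have hn := continuous_torusNorm
  have hw := continuous_cauchyWeight hr
  have hwx := cauchyWeight_pos hr x
  have hpt : ∀ y, cauchyWeight r x / 9 *
      (k (x - y) - 1 / r ^ 4 * (torusNorm (x - y) ^ 4 * k (x - y))) ≤
      cauchyWeight r y * k (x - y) := by
    intro y
    have hk := hk0 (x - y)
    have hwy := cauchyWeight_pos hr y
    rcases le_total (torusNorm (x - y)) r with h | h
    · have h1 := cauchyWeight_le hr h
      have := torusNorm_nonneg (x - y)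
      have h2 : 0 ≤ 1 / r ^ 4 * (torusNorm (x - y) ^ 4 * k (x - y)) := by positivity
      calc _ ≤ cauchyWeight r x / 9 * k (x - y) := by
            gcongr
            linarith
        _ ≤ _ := by
            gcongr
            linarith
    · have h4 : 1 ≤ 1 / r ^ 4 * torusNorm (x - y) ^ 4 := by
        rw [one_div_mul_eq_div, one_le_div (by positivity)]
        gcongr
      refine (mul_nonpos_of_nonneg_of_nonpos (by positivity) (by nlinarith)).trans ?_
      positivity
  have h5 := integral_mono (integrable_torus (by fun_prop)) (integrable_torus (by fun_prop)) hpt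
  rw [integral_const_mul, integral_sub (integrable_torus (by fun_prop))
    (integrable_torus (by fun_prop)), integral_const_mul, integral_sub_torus k,
    integral_sub_torus (fun z => torusNorm z ^ 4 * k z), hk1] at h5
  refine le_trans ?_ h5
  rw [div_eq_mul_one_div B, mul_comm B]
  gcongr

end Concentration

/-! ### Profiles before smoothing: masses and L¹ bounds. -/

theorem integral_indicator_disc {r : ℝ} (hr0 : 0 ≤ r) (hr : r ≤ 1 / 2) :
    ∫ y, (disc (0 : Torus) r).indicator (fun _ => (1 : ℝ)) y = Real.pi * r ^ 2 := by
  rw [integral_indicator_const _ (measurableSet_disc r), volume_disc_eq hr0 hr, smul_eq_mul,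
    mul_one]

theorem integrable_indicator_disc (r : ℝ) :
    Integrable ((disc (0 : Torus) r).indicator fun _ => (1 : ℝ)) :=
  (integrable_const (1 : ℝ)).indicator (measurableSet_disc r)

theorem indicator_disc_nonneg (r : ℝ) (y : Torus) :
    0 ≤ (disc (0 : Torus) r).indicator (fun _ => (1 : ℝ)) y :=
  Set.indicator_nonneg (fun _ _ => zero_le_one) y

/-- Before smoothing, the majorant of the indicator function of the disc of radius `r`. -/
def upperProfile (r ε η : ℝ) (y : Torus) : ℝ :=
  (1 - η)⁻¹ * (disc 0 (r + ε * r)).indicator (fun _ => (1 : ℝ)) y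

/-- Before smoothing, the minorant of the indicator function of the disc of radius `r`. -/
def lowerProfile (r ε η : ℝ) (y : Torus) : ℝ :=
  (disc 0 (r * (1 - ε))).indicator (fun _ => (1 : ℝ)) y - 72 * η * cauchyWeight r y

section Profiles

variable {r ε η : ℝ}

theorem integrable_upperProfile : Integrable (upperProfile r ε η) :=
  (integrable_indicator_disc _).const_mul _

theorem integrable_lowerProfile (hr : 0 < r) : Integrable (lowerProfile r ε η) :=
  (integrable_indicator_disc _).sub ((integrable_torus (continuous_cauchyWeight hr)).const_mul _)

theorem upperProfile_nonneg (hη : η ≤ 1 / 2) (y : Torus) : 0 ≤ upperProfile r ε η y :=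
  mul_nonneg (inv_nonneg.2 (by linarith)) (indicator_disc_nonneg _ _)

theorem integral_upperProfile (hr : 0 < r) (hr1 : r ≤ 1 / 4) (hε : 0 < ε) (hε1 : ε ≤ 1 / 2) :
    ∫ y, upperProfile r ε η y = (1 - η)⁻¹ * (Real.pi * (r + ε * r) ^ 2) := by
  unfold upperProfile
  rw [integral_const_mul, integral_indicator_disc (by positivity) (by nlinarith)]

theorem integral_lowerProfile (hr : 0 < r) (hr1 : r ≤ 1 / 4) (hε : 0 < ε) (hε1 : ε ≤ 1 / 2) :
    ∫ y, lowerProfile r ε η y =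
      Real.pi * (r * (1 - ε)) ^ 2 - 72 * η * ∫ y, cauchyWeight r y := by
  unfold lowerProfile
  rw [integral_sub (integrable_indicator_disc _)
    ((integrable_torus (continuous_cauchyWeight hr)).const_mul _), integral_const_mul,
    integral_indicator_disc (mul_nonneg hr.le (by linarith)) (by nlinarith)]

theorem integral_cauchyWeight_le' (hr : 0 < r) : ∫ y, cauchyWeight r y ≤ 16 * r ^ 2 := by
  refine (integral_cauchyWeight_le hr).trans ?_
  have := Real.pi_le_four
  have := Real.pi_pos
  rw [mul_pow]
  gcongr
  nlinarith

theorem integral_cauchyWeight_nonneg (hr : 0 < r) : 0 ≤ ∫ y, cauchyWeight r y :=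
  integral_nonneg fun y => (cauchyWeight_pos hr y).le

theorem inv_one_sub_le (hη0 : 0 ≤ η) (hη : η ≤ 1 / 2) : (1 - η)⁻¹ ≤ 1 + 2 * η := by
  rw [inv_le_iff_one_le_mul₀ (by linarith)]
  nlinarith

theorem integral_abs_upperProfile_le (hr : 0 < r) (hr1 : r ≤ 1 / 4) (hε : 0 < ε)
    (hε1 : ε ≤ 1 / 2) (hη0 : 0 ≤ η) (hη : η ≤ 1 / 2) :
    ∫ y, |upperProfile r ε η y| ≤ 2000 * r ^ 2 := by
  simp_rw [abs_of_nonneg (upperProfile_nonneg hη _)]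
  rw [integral_upperProfile hr hr1 hε hε1]
  have h2 := inv_one_sub_le hη0 hη
  calc (1 - η)⁻¹ * (Real.pi * (r + ε * r) ^ 2) ≤ 2 * (4 * (r + 1 / 2 * r) ^ 2) := by
        gcongr
        · linarith
        · exact Real.pi_le_four
    _ ≤ _ := by nlinarith [sq_nonneg r]

theorem integral_abs_lowerProfile_le (hr : 0 < r) (hr1 : r ≤ 1 / 4) (hε : 0 < ε)
    (hε1 : ε ≤ 1 / 2) (hη0 : 0 ≤ η) (hη : η ≤ 1 / 2) :
    ∫ y, |lowerProfile r ε η y| ≤ 2000 * r ^ 2 := by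
  have hwi : Integrable (cauchyWeight r) := integrable_torus (continuous_cauchyWeight hr)
  have h1 : ∀ y, |lowerProfile r ε η y| ≤
      (disc 0 (r * (1 - ε))).indicator (fun _ => (1 : ℝ)) y + 72 * η * cauchyWeight r y := by
    intro y
    have h2 := indicator_disc_nonneg (r * (1 - ε)) y
    have h3 := cauchyWeight_pos hr y
    have h4 : 0 ≤ 72 * η * cauchyWeight r y := by positivity
    unfold lowerProfile
    rw [abs_le]
    constructor <;> linarith
  have h4 := integral_mono (integrable_lowerProfile hr).abs
    ((integrable_indicator_disc (r * (1 - ε))).add (hwi.const_mul (72 * η))) h1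
  simp only [Pi.add_apply] at h4
  rw [integral_add (integrable_indicator_disc _) (hwi.const_mul _), integral_const_mul,
    integral_indicator_disc (mul_nonneg hr.le (by linarith)) (by nlinarith)] at h4
  refine h4.trans ?_
  have h5 : (r * (1 - ε)) ^ 2 ≤ r ^ 2 :=
    pow_le_pow_left₀ (mul_nonneg hr.le (by linarith)) (by nlinarith) 2
  have h6 := integral_cauchyWeight_le' hr
  have h7 := integral_cauchyWeight_nonneg hr
  calc _ ≤ 4 * r ^ 2 + 72 * (1 / 2) * (16 * r ^ 2) := by
        gcongr
        exact Real.pi_le_four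
    _ ≤ _ := by nlinarith [sq_nonneg r]

theorem abs_integral_upperProfile_sub_le (hr : 0 < r) (hr1 : r ≤ 1 / 4) (hε : 0 < ε)
    (hε1 : ε ≤ 1 / 2) (hη0 : 0 ≤ η) (hη : η ≤ 1 / 2) :
    |(∫ y, upperProfile r ε η y) - Real.pi * r ^ 2| ≤ 2000 * (ε + η) * r ^ 2 := by
  rw [integral_upperProfile hr hr1 hε hε1]
  have h1 : 1 ≤ (1 - η)⁻¹ := (one_le_inv₀ (by linarith)).2 (by linarith)
  have h2 := inv_one_sub_le hη0 hη
  have h3 : (1 - η)⁻¹ * (1 + ε) ^ 2 ≤ 1 + 6 * (ε + η) := by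
    calc (1 - η)⁻¹ * (1 + ε) ^ 2 ≤ (1 + 2 * η) * (1 + 3 * ε) := by
          gcongr
          nlinarith
      _ ≤ _ := by nlinarith
  have h4 : 1 ≤ (1 - η)⁻¹ * (1 + ε) ^ 2 := one_le_mul_of_one_le_of_one_le h1 (by nlinarith)
  rw [show (1 - η)⁻¹ * (Real.pi * (r + ε * r) ^ 2) - Real.pi * r ^ 2 =
    Real.pi * r ^ 2 * ((1 - η)⁻¹ * (1 + ε) ^ 2 - 1) by ring,
    abs_of_nonneg (mul_nonneg (by positivity) (by linarith))]
  calc _ ≤ 4 * r ^ 2 * (6 * (ε + η)) := by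
        gcongr
        · exact Real.pi_le_four
        · linarith
    _ ≤ _ := by nlinarith [show 0 ≤ (ε + η) * r ^ 2 by positivity]

/-- Shrinking the disc costs at most 8εr² and the subtracted weight at most 72 · 16 ηr². The latter
dictates the size of the generous constant 2000. -/
theorem abs_integral_lowerProfile_sub_le (hr : 0 < r) (hr1 : r ≤ 1 / 4) (hε : 0 < ε)
    (hε1 : ε ≤ 1 / 2) (hη0 : 0 ≤ η) :
    |(∫ y, lowerProfile r ε η y) - Real.pi * r ^ 2| ≤ 2000 * (ε + η) * r ^ 2 := by
  rw [integral_lowerProfile hr hr1 hε hε1]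
  have h6 := integral_cauchyWeight_le' hr
  have h7 := integral_cauchyWeight_nonneg hr
  have h8 : 0 ≤ 72 * η * ∫ y, cauchyWeight r y := by positivity
  have h9 : 72 * η * ∫ y, cauchyWeight r y ≤ 72 * η * (16 * r ^ 2) := by gcongr
  have hpr : 0 < Real.pi * r ^ 2 := by positivity
  have h10 : Real.pi * r ^ 2 * ε ≤ 4 * r ^ 2 * ε := by
    gcongr
    exact Real.pi_le_four
  have h11 : Real.pi * (r * (1 - ε)) ^ 2 =
      Real.pi * r ^ 2 - Real.pi * r ^ 2 * ε * (2 - ε) := by ring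
  have h12 : 0 ≤ r ^ 2 * η := by positivity
  have h13 : 0 ≤ r ^ 2 * ε := by positivity
  have h14 : 0 ≤ Real.pi * r ^ 2 * ε := by positivity
  rw [h11, abs_le]
  constructor <;> nlinarith

end Profiles

/-! ### Smoothed profiles as majorant and minorant. -/

section Smoothing

variable {k : Torus → ℝ} {B r ε η : ℝ}

/-- At most η of the kernel's mass escapes beyond the margin εr, so smoothing leaves at least 1 − η
on the disc; the prefactor restores 1. -/
theorem indicator_le_integral_upperProfile (hkc : Continuous k) (hk0 : ∀ x, 0 ≤ k x)
    (hk1 : ∫ x, k x = 1) (hB : ∫ x, torusNorm x ^ 4 * k x ≤ B) (hr : 0 < r) (hε : 0 < ε)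
    (hη : B / (ε * r) ^ 4 = η) (hη1 : η ≤ 1 / 2) (x : Torus) :
    (disc 0 r).indicator (fun _ => (1 : ℝ)) x ≤ ∫ y, upperProfile r ε η y * k (x - y) := by
  by_cases hx : x ∈ disc 0 r
  · rw [Set.indicator_of_mem hx]
    have h1 := le_integral_disc_mul hkc hk0 hk1 hB (mul_pos hε hr) hx
    rw [hη] at h1
    simp only [upperProfile, mul_assoc]
    rw [integral_const_mul, inv_mul_eq_div, one_le_div (by linarith)]
    exact h1
  · rw [Set.indicator_of_notMem hx]
    exact integral_nonneg fun y => mul_nonneg (upperProfile_nonneg hη1 y) (hk0 _)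

theorem integral_lowerProfile_mul (hkc : Continuous k) (hr : 0 < r) (x : Torus) :
    ∫ y, lowerProfile r ε η y * k (x - y) =
      (∫ y, (disc 0 (r * (1 - ε))).indicator (fun _ => (1 : ℝ)) y * k (x - y)) -
        72 * η * ∫ y, cauchyWeight r y * k (x - y) := by
  have hwi : Integrable (cauchyWeight r) := integrable_torus (continuous_cauchyWeight hr)
  rw [← integral_const_mul, ← integral_sub (integrable_mul_sub (integrable_indicator_disc _)
    hkc x) ((integrable_mul_sub hwi hkc x).const_mul _)]
  congr 1
  ext y
  simp only [lowerProfile]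
  ring

theorem integral_indicator_disc_mul_le_one (hkc : Continuous k) (hk0 : ∀ x, 0 ≤ k x)
    (hk1 : ∫ x, k x = 1) (x : Torus) :
    ∫ y, (disc 0 r).indicator (fun _ => (1 : ℝ)) y * k (x - y) ≤ 1 := by
  refine le_trans (integral_mono (integrable_mul_sub (integrable_indicator_disc _) hkc x)
    (integrable_torus (f := fun y => k (x - y)) (by fun_prop)) fun y => ?_)
    (le_of_eq ((integral_sub_torus k x).trans hk1))
  refine mul_le_of_le_one_left (hk0 _) ?_
  exact Set.indicator_apply_le' (fun _ => le_rfl) (fun _ => zero_le_one)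

theorem div_mul_pow_four (hr : 0 < r) (ρ : ℝ) :
    B / (ε * ρ) ^ 4 = B / (ε * r) ^ 4 * (r / ρ) ^ 4 := by
  field_simp

/-- Inside the disc, smoothing keeps the indicator at most 1 and the weight only lowers it. Outside,
the tail is at most η(r/|x|)⁴ ≤ 4η w(x), and the smoothed weight is at least w(x)/18; hence the
coefficient 72 = 4 · 18. -/
theorem integral_lowerProfile_le_indicator (hkc : Continuous k) (hk0 : ∀ x, 0 ≤ k x)
    (hk1 : ∫ x, k x = 1) (hB : ∫ x, torusNorm x ^ 4 * k x ≤ B) (hB0 : 0 ≤ B) (hr : 0 < r)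
    (hε : 0 < ε) (hε1 : ε ≤ 1 / 2) (hη : B / (ε * r) ^ 4 = η) (hη1 : η ≤ 1 / 2) (x : Torus) :
    ∫ y, lowerProfile r ε η y * k (x - y) ≤ (disc 0 r).indicator (fun _ => (1 : ℝ)) x := by
  have hη0 : 0 ≤ η := by
    rw [← hη]
    positivity
  have hBr : B / r ^ 4 ≤ 1 / 2 := by
    refine le_trans ?_ hη1
    rw [← hη]
    have : (ε * r) ^ 4 ≤ r ^ 4 := by
      gcongr
      nlinarith
    gcongr
  have hwk := cauchyWeight_le_integral_mul hkc hk0 hk1 hB hr x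
  have hwx := cauchyWeight_pos hr x
  have hwk' : cauchyWeight r x / 18 ≤ ∫ y, cauchyWeight r y * k (x - y) := by
    refine le_trans ?_ hwk
    nlinarith
  rw [integral_lowerProfile_mul hkc hr]
  by_cases hx : x ∈ disc 0 r
  · rw [Set.indicator_of_mem hx]
    have h1 := integral_indicator_disc_mul_le_one (r := r * (1 - ε)) hkc hk0 hk1 x
    have h2 : 0 ≤ 72 * η * ∫ y, cauchyWeight r y * k (x - y) := by
      exact mul_nonneg (by linarith) (le_trans (by linarith) hwk')
    linarith
  · rw [Set.indicator_of_notMem hx]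
    have h1 := integral_disc_mul_le hkc hk0 hB hr hε (by linarith) hx
    rw [mem_disc_zero, not_lt] at hx
    have hx0 : 0 < torusNorm x := hr.trans_le hx
    rw [div_mul_pow_four hr, hη] at h1
    have h3 := mul_le_mul_of_nonneg_left (le_cauchyWeight hr hx) hη0
    have h4 := mul_le_mul_of_nonneg_left hwk' (show 0 ≤ 72 * η by positivity)
    linarith

end Smoothing

/-! ### Existence of admissible majorants and minorants. -/

/-- The properties of a majorant and a minorant of degree less than `d` of the indicator function
of the disc of radius `r`, with Fourier coefficients at most `c` and integrals off by at
most `δ`. -/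
structure IsDiscPair (r d c δ : ℝ) (aPlus aMinus : TrigPoly) : Prop where
  real : ∀ y : Torus, (aPlus.eval y).im = 0 ∧ (aMinus.eval y).im = 0
  majorant : ∀ y : Torus, (disc 0 r).indicator (fun _ => (1 : ℝ)) y ≤ (aPlus.eval y).re
  minorant : ∀ y : Torus, (aMinus.eval y).re ≤ (disc 0 r).indicator (fun _ => (1 : ℝ)) y
  degree : ∀ n : ℤ × ℤ, d ≤ √((n.1 : ℝ) ^ 2 + (n.2 : ℝ) ^ 2) → aPlus n = 0 ∧ aMinus n = 0
  coeff : ∀ n : ℤ × ℤ, ‖aPlus n‖ ≤ c ∧ ‖aMinus n‖ ≤ c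
  integral : ‖aPlus 0 - (volume.real (disc 0 r) : ℂ)‖ ≤ δ ∧
    ‖aMinus 0 - (volume.real (disc 0 r) : ℂ)‖ ≤ δ

/-- Both profiles are convolved with one kernel K. Since |K n| ≤ 1, coefficients are bounded by the
L¹ norms of the profiles; since K 0 = 1, integrals are unchanged. The number η bounds the kernel's
mass beyond distance εr. -/
theorem exists_isDiscPair :
    ∃ C : ℝ, 0 < C ∧ ∀ r d ε η : ℝ, 0 < r → r ≤ 1 / 4 → 0 < d → 0 < ε → ε ≤ 1 / 2 →
      C / (d * ε * r) ^ 4 = η → η ≤ 1 / 2 →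
      ∃ aPlus aMinus : TrigPoly,
        IsDiscPair r d (2000 * r ^ 2) (2000 * (ε + η) * r ^ 2) aPlus aMinus := by
  obtain ⟨C, hC, hker⟩ := exists_kernel
  refine ⟨C, hC, fun r d ε η hr hr1 hd hε hε1 hη hη1 => ?_⟩
  obtain ⟨K, k, hkc, hk0, hK, hk1, hdeg, hB⟩ := hker d hd
  have hη0 : 0 ≤ η := by
    rw [← hη]
    positivity
  have hη' : C / d ^ 4 / (ε * r) ^ 4 = η := by
    rw [← hη, div_div, ← mul_pow, mul_assoc]
  have hi₁ : Integrable (upperProfile r ε η) := integrable_upperProfile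
  have hi₂ : Integrable (lowerProfile r ε η) := integrable_lowerProfile hr
  have hcoeff : ∀ (f : Torus → ℝ) (n : ℤ × ℤ), ∫ y, |f y| ≤ 2000 * r ^ 2 →
      ‖K.conv f n‖ ≤ 2000 * r ^ 2 := by
    intro f n hf
    refine (K.norm_conv_apply_le f n).trans (le_trans ?_ hf)
    exact mul_le_of_le_one_left (integral_nonneg fun y => abs_nonneg _)
      (norm_apply_le_one hK hk0 hk1 n)
  have hint : ∀ f : Torus → ℝ, K.conv f 0 - (volume.real (disc (0 : Torus) r) : ℂ) =
      (((∫ y, f y) - Real.pi * r ^ 2 : ℝ) : ℂ) := by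
    intro f
    rw [TrigPoly.conv_apply_zero, apply_zero_eq_one hK hk1, one_mul,
      volume_disc_eq hr.le (by linarith), ← Complex.ofReal_sub]
  refine ⟨K.conv (upperProfile r ε η), K.conv (lowerProfile r ε η), ?_, ?_, ?_, ?_, ?_, ?_⟩
  · intro y
    rw [TrigPoly.eval_conv hK hi₁, TrigPoly.eval_conv hK hi₂]
    exact ⟨Complex.ofReal_im _, Complex.ofReal_im _⟩
  · intro x
    rw [TrigPoly.eval_conv hK hi₁, Complex.ofReal_re]
    exact indicator_le_integral_upperProfile hkc hk0 hk1 hB hr hε hη' hη1 x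
  · intro x
    rw [TrigPoly.eval_conv hK hi₂, Complex.ofReal_re]
    exact integral_lowerProfile_le_indicator hkc hk0 hk1 hB (by positivity) hr hε hε1 hη' hη1 x
  · intro n hn
    rw [TrigPoly.conv_apply, TrigPoly.conv_apply, hdeg n hn]
    simp
  · exact fun n => ⟨hcoeff _ n (integral_abs_upperProfile_le hr hr1 hε hε1 hη0 hη1),
      hcoeff _ n (integral_abs_lowerProfile_le hr hr1 hε hε1 hη0 hη1)⟩
  · rw [hint, hint, Complex.norm_real, Complex.norm_real]
    exact ⟨abs_integral_upperProfile_sub_le hr hr1 hε hε1 hη0 hη1,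
      abs_integral_lowerProfile_sub_le hr hr1 hε hε1 hη0⟩

theorem exists_isMajorantMinorant {r D : ℕ → ℝ} (hr0 : ∀ᶠ N in atTop, 0 < r N)
    (hr : Tendsto r atTop (𝓝 0)) (hD : Tendsto (fun N => r N * D N) atTop atTop) :
    ∃ aPlus aMinus : ℕ → TrigPoly, IsMajorantMinorant r D aPlus aMinus := by
  classical
  obtain ⟨C, hC, hex⟩ := exists_isDiscPair
  set q : ℕ → ℝ := fun N => r N * D N with hq
  -- With q = rD → ∞ this choice gives Dεr = √q, so ε and η = C/q² both tend to 0.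
  set ε : ℕ → ℝ := fun N => (√(q N))⁻¹ with hε
  set η : ℕ → ℝ := fun N => C / q N ^ 2 with hη
  have hεlim : Tendsto ε atTop (𝓝 0) :=
    tendsto_inv_atTop_zero.comp (Real.tendsto_sqrt_atTop.comp hD)
  have hηlim : Tendsto η atTop (𝓝 0) :=
    ((tendsto_pow_atTop two_ne_zero).comp hD).const_div_atTop C
  have hgood : ∀ᶠ N in atTop, ∃ a : TrigPoly × TrigPoly,
      IsDiscPair (r N) (D N) (2000 * r N ^ 2) (2000 * (ε N + η N) * r N ^ 2) a.1 a.2 := by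
    filter_upwards [hr0, hr.eventually_le_const (show (0 : ℝ) < 1 / 4 by norm_num),
      hD.eventually_gt_atTop 0, hεlim.eventually_le_const (show (0 : ℝ) < 1 / 2 by norm_num),
      hηlim.eventually_le_const (show (0 : ℝ) < 1 / 2 by norm_num)] with N h1 h2 h3 h4 h5
    have hD0 : 0 < D N := (pos_iff_pos_of_mul_pos h3).1 h1
    have hq0 : 0 < √(q N) := Real.sqrt_pos.2 h3
    obtain ⟨a, b, hab⟩ := hex (r N) (D N) (ε N) (η N) h1 h2 hD0 (inv_pos.2 hq0) h4 (by
      simp only [hη, hε]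
      congr 1
      have hs : √(q N) ^ 2 = q N := Real.sq_sqrt h3.le
      have : D N * (√(q N))⁻¹ * r N = √(q N) := by
        field_simp
        rw [hs, hq, mul_comm]
      rw [this, show √(q N) ^ 4 = (√(q N) ^ 2) ^ 2 by ring, hs]) h5
    exact ⟨(a, b), hab⟩
  -- The value 0 at the remaining N is harmless, as every requirement is asymptotic.
  set a : ℕ → TrigPoly × TrigPoly := fun N => if h : ∃ a : TrigPoly × TrigPoly,
      IsDiscPair (r N) (D N) (2000 * r N ^ 2) (2000 * (ε N + η N) * r N ^ 2) a.1 a.2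
    then h.choose else 0 with ha
  have hpair : ∀ᶠ N in atTop,
      IsDiscPair (r N) (D N) (2000 * r N ^ 2) (2000 * (ε N + η N) * r N ^ 2)
        (a N).1 (a N).2 := by
    filter_upwards [hgood] with N h
    simp only [ha, dif_pos h]
    exact h.choose_spec
  have hsmall : ∀ c : ℝ, 0 < c → ∀ᶠ N in atTop, 2000 * (ε N + η N) ≤ c := by
    intro c hc
    have := (hεlim.add hηlim).const_mul 2000
    rw [add_zero, mul_zero] at this
    exact this.eventually_le_const hc
  refine ⟨fun N => (a N).1, fun N => (a N).2, hpair.mono fun N h => h.real,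
    hpair.mono fun N h => h.majorant, hpair.mono fun N h => h.minorant,
    hpair.mono fun N h => h.degree, ⟨2000, hpair.mono fun N h => h.coeff⟩, ?_, ?_⟩
  · refine IsLittleO.of_bound fun c hc => ?_
    filter_upwards [hpair, hsmall c hc] with N h1 h2
    rw [Real.norm_of_nonneg (sq_nonneg _)]
    exact h1.integral.1.trans (by gcongr)
  · refine IsLittleO.of_bound fun c hc => ?_
    filter_upwards [hpair, hsmall c hc] with N h1 h2
    rw [Real.norm_of_nonneg (sq_nonneg _)]
    exact h1.integral.2.trans (by gcongr)

theorem disc_one (x : Torus) : disc x 1 = Set.univ := by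
  refine Set.eq_univ_of_forall fun y => ?_
  have h : ∀ t : UnitAddCircle, ‖t‖ ≤ 1 / 2 := fun t => by
    simpa using AddCircle.norm_le_half_period 1 (x := t) one_ne_zero
  have h1 : ‖y.1 - x.1‖ ^ 2 ≤ (1 / 2) ^ 2 := pow_le_pow_left₀ (norm_nonneg _) (h _) 2
  have h2 : ‖y.2 - x.2‖ ^ 2 ≤ (1 / 2) ^ 2 := pow_le_pow_left₀ (norm_nonneg _) (h _) 2
  change √(‖y.1 - x.1‖ ^ 2 + ‖y.2 - x.2‖ ^ 2) < 1
  rw [Real.sqrt_lt' one_pos]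
  linarith

/-- A disc of radius 1 is the whole torus, so the constant 1 is both majorant and minorant. This
covers α = 0, where r is too large for the small-disc construction. -/
theorem isMajorantMinorant_one {D : ℕ → ℝ} (hD : ∀ᶠ N in atTop, 0 < D N) :
    IsMajorantMinorant (fun _ => 1) D (fun _ => Finsupp.single 0 1)
      (fun _ => Finsupp.single 0 1) := by
  have heval : ∀ y, TrigPoly.eval (Finsupp.single 0 1) y = 1 := by
    intro y
    rw [TrigPoly.eval, Finsupp.sum_single_index (zero_mul _), character_zero, one_mul]
  refine ⟨?_, ?_, ?_, ?_, ⟨1, ?_⟩, ?_, ?_⟩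
  · simp [heval]
  · simp [heval, disc_one]
  · simp [heval, disc_one]
  · filter_upwards [hD] with N hN n hn
    have : n ≠ 0 := by
      rintro rfl
      simp at hn
      linarith
    simp [this.symm]
  · refine Eventually.of_forall fun N n => ?_
    have : ‖(Finsupp.single 0 1 : TrigPoly) n‖ ≤ 1 * 1 ^ 2 := by
      rw [Finsupp.single_apply]
      split_ifs <;> simp
    exact ⟨this, this⟩
  · simp [disc_one]
  · simp [disc_one]

end QuantumCat

end

theorem theorem1p3 (M : SL(2, ℤ)) (hM : 2 < |(M : Matrix (Fin 2) (Fin 2) ℤ).trace|)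
    (α : ℝ) (hα0 : 0 ≤ α) (hα1 : α < 1 / 4)
    (r : ℕ → ℝ) (hr : ∀ N : ℕ, r N = Real.log N ^ (-α))
    (D : ℕ → ℝ) (hD : Tendsto (fun N => r N * D N) atTop atTop)
    (hD' : (fun N : ℕ => D N ^ 4) =o[atTop] fun N : ℕ => Real.log N) :
    (∃ aPlus aMinus : ℕ → QuantumCat.TrigPoly,
      QuantumCat.IsMajorantMinorant r D aPlus aMinus) ∧
    ∀ aPlus aMinus : ℕ → QuantumCat.TrigPoly,
      QuantumCat.IsMajorantMinorant r D aPlus aMinus →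
      QuantumCat.QuantumErgodicityAtScale M r aPlus aMinus := by
  have hlog : Tendsto (fun N : ℕ => Real.log N) atTop atTop :=
    Real.tendsto_log_atTop.comp tendsto_natCast_atTop_atTop
  have hr0 : ∀ᶠ N in atTop, 0 < r N := by
    filter_upwards [hlog.eventually_gt_atTop 0] with N hN
    rw [hr]
    exact Real.rpow_pos_of_pos hN _
  have hr1 : ∀ᶠ N in atTop, r N ≤ 1 := by
    filter_upwards [hlog.eventually_ge_atTop 1] with N hN
    rw [hr]
    exact Real.rpow_le_one_of_one_le_of_nonpos hN (by linarith)
  -- Eventually r ≤ 1, so D dominates rD.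
  have hDtop : Tendsto D atTop atTop := by
    refine tendsto_atTop_mono' _ ?_ hD
    filter_upwards [hr0, hr1, hD.eventually_gt_atTop 0] with N h1 h2 h3
    exact mul_le_of_le_one_left ((pos_iff_pos_of_mul_pos h3).1 h1).le h2
  refine ⟨?_, fun aPlus aMinus ha => ha.quantumErgodicityAtScale ?_
    (hr0.mono fun N h => h.ne') hDtop hD'⟩
  -- The radius tends to 0 only for α > 0; for α = 0 it is identically 1.
  · rcases hα0.eq_or_lt with h | h
    · have : r = fun _ => 1 := by
        funext N
        rw [hr, ← h, neg_zero, Real.rpow_zero]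
      rw [this]
      exact ⟨_, _, QuantumCat.isMajorantMinorant_one (hDtop.eventually_gt_atTop 0)⟩
    · have hrlim : Tendsto r atTop (𝓝 0) := by
        rw [show r = fun N : ℕ => Real.log N ^ (-α) from funext hr]
        exact (tendsto_rpow_neg_atTop h).comp hlog
      exact QuantumCat.exists_isMajorantMinorant hr0 hrlim hD
  · rwa [Matrix.trace_fin_two] at hM
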